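/- Let $\mathcal G$ be an ample groupoid, that is, a topological groupoid whose unit space $\mathcal G^0$ is locally compact, Hausdorff and totally disconnected and whose source map $s\colon \mathcal G\to\mathcal G^0$ is a local homeomorphism; $\mathcal G$ itself is not assumed to be Hausdorff. Let $\mathbb Z\mathcal G$ be the group of functions $\mathcal G\to\mathbb Z$ generated by the characteristic functions of compact (meaning quasi-compact and Hausdorff) open subsets of $\mathcal G$, a ring under the convolution $(f*h)(g)=\sum_{r(a)=r(g)}f(a)h(a^{-1}g)$, where $r$ is the range map. Let $\mathbb Z\mathcal G^0$ be the group of functions $\mathcal G^0\to\mathbb Z$ generated by the characteristic functions of compact open subsets of $\mathcal G^0$, a right $\mathbb Z\mathcal G$-module under $(hf)(x)=\sum_{s(g)=x}h(r(g))f(g)$. A left $\mathbb Z\mathcal G$-module $M$ is unitary if $\mathbb Z\mathcal G\cdot M=M$; for such $M$ put $H_n(\mathcal G,M)=\mathrm{Tor}_n^{\mathbb Z\mathcal G}(\mathbb Z\mathcal G^0,M)$, where $\mathrm{Tor}_n^{\mathbb Z\mathcal G}(\mathbb Z\mathcal G^0,-)$ is the $n$-th left derived functor of $\mathbb Z\mathcal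 G^0\otimes_{\mathbb Z\mathcal G}-$ on the abelian category of unitary left $\mathbb Z\mathcal G$-modules. The homological dimension of $\mathcal G$ is $\sup\{n\ge 0\mid H_n(\mathcal G,M)\neq 0\text{ for some unitary }M\}$, where $\sup\emptyset=0$. Call $\mathcal G$ AF if it is a directed union of compact open subgroupoids that are principal, i.e. have trivial isotropy (a subgroupoid need not contain all of $\mathcal G^0$). Theorem A. The groupoid $\mathcal G$ is AF if and only if it has homological dimension $0$. Equivalently, $\mathcal G$ is AF if and only if $H_n(\mathcal G,M)=0$ for all $n>0$ and every unitary left $\mathbb Z\mathcal G$-module $M$. -/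

import Mathlib

universe u

open CategoryTheory

namespace AmpleHomology

/-- Every two elements of the (possibly non-unital) ring `A` have a common idempotent left unit. -/
class HasLeftLocalUnits (A : Type u) [NonUnitalRing A] : Prop where
  exists_unit : ∀ a b : A, ∃ e : A, e * e = e ∧ e * a = a ∧ e * b = b

section Modules

variable (A : Type u) [NonUnitalRing A]

/-- The unital ring `ℤ ⊕ A` obtained from the (possibly non-unital) ring `A` by adjoining a unit.
Its unital modules are the same thing as the modules over `A`. -/
def AdjoinUnit : Type u := Unitization ℤ A

noncomputable instance : Ring (AdjoinUnit A) := inferInstanceAs (Ring (Unitization ℤ A))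

variable {A}

/-- The inclusion of `A` in `ℤ ⊕ A`. -/
def incl : A →ₙ+* AdjoinUnit A where
  toFun a := (Unitization.inr a : Unitization ℤ A)
  map_zero' := Unitization.inr_zero _
  map_add' := Unitization.inr_add _
  map_mul' := Unitization.inr_mul _

theorem exists_incl_eq_mul (x : AdjoinUnit A) (a : A) : ∃ b : A, incl b = x * incl a :=
  ⟨x.toProd.1 • a + x.toProd.2 * a, by
    refine Unitization.ext (mul_zero x.toProd.1).symm ?_
    change _ = x.toProd.1 • a + (0 : ℤ) • x.toProd.2 + x.toProd.2 * a
    rw [zero_smul, add_zero]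
    rfl⟩

variable (A) in
/-- A left `A`-module `M`, that is, a unital left module over `ℤ ⊕ A`, is *unitary* if `A M = M`,
i.e. if `M` is generated as an abelian group by the products `a m` with `a ∈ A` and `m ∈ M`. -/
def isUnitary : ObjectProperty (ModuleCat.{u} (AdjoinUnit A)) := fun M =>
  AddSubgroup.closure {x : M | ∃ (a : A) (m : M), x = incl a • m} = ⊤

variable (A) in
/-- The category of unitary left `A`-modules, with all `A`-linear maps as morphisms. -/
abbrev UnitaryMod : Type (u + 1) := (isUnitary A).FullSubcategory

theorem isUnitary_iff [HasLeftLocalUnits A] (M : ModuleCat.{u} (AdjoinUnit A)) :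
    isUnitary A M ↔ ∀ m : M, ∃ e : A, e * e = e ∧ incl e • m = m := by
  constructor
  · intro h m
    have hm : m ∈ AddSubgroup.closure {x : M | ∃ (a : A) (m : M), x = incl a • m} := by
      rw [show _ = _ from h]; trivial
    induction hm using AddSubgroup.closure_induction with
    | mem x hx =>
      obtain ⟨a, m, rfl⟩ := hx
      obtain ⟨e, he, hea, -⟩ := HasLeftLocalUnits.exists_unit a a
      exact ⟨e, he, by rw [smul_smul, ← map_mul, hea]⟩
    | zero =>
      obtain ⟨e, he, -⟩ := HasLeftLocalUnits.exists_unit (0 : A) 0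
      exact ⟨e, he, smul_zero _⟩
    | add x y _ _ hx hy =>
      obtain ⟨e, -, hx⟩ := hx
      obtain ⟨f, -, hy⟩ := hy
      obtain ⟨d, hd, hde, hdf⟩ := HasLeftLocalUnits.exists_unit e f
      refine ⟨d, hd, ?_⟩
      rw [smul_add]
      congr 1
      · conv_lhs => rw [← hx, smul_smul, ← map_mul, hde, hx]
      · conv_lhs => rw [← hy, smul_smul, ← map_mul, hdf, hy]
    | neg x _ hx =>
      obtain ⟨e, he, hx⟩ := hx
      exact ⟨e, he, by rw [smul_neg, hx]⟩
  · intro h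
    rw [isUnitary, eq_top_iff]
    intro m _
    obtain ⟨e, -, he⟩ := h m
    exact AddSubgroup.subset_closure ⟨e, m, he.symm⟩

variable [HasLeftLocalUnits A]

instance : (isUnitary A).IsClosedUnderSubobjects where
  prop_of_mono {M N} f _ hN := by
    rw [isUnitary_iff] at hN ⊢
    intro m
    obtain ⟨e, he, h⟩ := hN (f.hom m)
    exact ⟨e, he, (ModuleCat.mono_iff_injective f).1 inferInstance (by
      change f.hom _ = f.hom _
      rw [map_smul, h])⟩

instance : (isUnitary A).IsClosedUnderQuotients where
  prop_of_epi {M N} f _ hM := by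
    rw [isUnitary_iff] at hM ⊢
    intro n
    obtain ⟨m, rfl⟩ := (ModuleCat.epi_iff_surjective f).1 inferInstance n
    obtain ⟨e, he, h⟩ := hM m
    refine ⟨e, he, ?_⟩
    change _ • f.hom m = f.hom m
    rw [← map_smul, h]

instance : (isUnitary A).ContainsZero where
  exists_zero := ⟨ModuleCat.of _ PUnit, ModuleCat.isZero_of_subsingleton _,
    (isUnitary_iff _).2 fun m => by
      obtain ⟨e, he, -⟩ := HasLeftLocalUnits.exists_unit (0 : A) 0
      exact ⟨e, he, Subsingleton.elim _ _⟩⟩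

instance : (isUnitary A).IsClosedUnderBinaryProducts := by
  refine .mk' ?_
  rintro _ ⟨F, hF⟩
  refine (isUnitary_iff _).2 fun m => ?_
  obtain ⟨e, -, he⟩ := (isUnitary_iff _).1 (hF ⟨.left⟩) ((Limits.limit.π F ⟨.left⟩).hom m)
  obtain ⟨f, -, hf⟩ := (isUnitary_iff _).1 (hF ⟨.right⟩) ((Limits.limit.π F ⟨.right⟩).hom m)
  obtain ⟨d, hd, hde, hdf⟩ := HasLeftLocalUnits.exists_unit e f
  refine ⟨d, hd, Limits.Concrete.limit_ext F _ _ ?_⟩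
  rintro ⟨_ | _⟩
  · change (Limits.limit.π F ⟨.left⟩).hom _ = (Limits.limit.π F ⟨.left⟩).hom _
    rw [map_smul]
    conv_lhs => rw [← he, smul_smul, ← map_mul, hde, he]
  · change (Limits.limit.π F ⟨.right⟩).hom _ = (Limits.limit.π F ⟨.right⟩).hom _
    rw [map_smul]
    conv_lhs => rw [← hf, smul_smul, ← map_mul, hdf, hf]

instance : (isUnitary A).IsClosedUnderFiniteProducts :=
  ObjectProperty.IsClosedUnderFiniteProducts.mk'

noncomputable instance : Abelian (UnitaryMod A) := inferInstance

/-- The direct sum of the left ideals `A e` over all pairs `(e, m)` with `e ∈ A` idempotent and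
`e m = m`; it is a projective unitary module mapping onto `M`. -/
noncomputable abbrev ProjCover (M : Type u) [AddCommGroup M] [Module (AdjoinUnit A) M] : Type u :=
  DirectSum {p : A × M // p.1 * p.1 = p.1 ∧ incl p.1 • p.2 = p.2}
    fun p => Submodule.span (AdjoinUnit A) {incl p.1.1}

theorem projective_span {A : Type u} [NonUnitalRing A] (e : A) (he : e * e = e) :
    Module.Projective (AdjoinUnit A) (Submodule.span (AdjoinUnit A) {incl e}) := by
  refine Module.Projective.of_split (Submodule.subtype _)
    ((LinearMap.toSpanSingleton (AdjoinUnit A) (AdjoinUnit A) (incl e)).codRestrict _ fun x =>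
        Submodule.smul_mem _ _ (Submodule.mem_span_singleton_self _)) ?_
  ext ⟨x, hx⟩ : 2
  obtain ⟨y, rfl⟩ := Submodule.mem_span_singleton.1 hx
  change (y * incl e) * incl e = y * incl e
  rw [mul_assoc, ← map_mul, he]

theorem projCover_projective {A : Type u} [NonUnitalRing A] (M : Type u) [AddCommGroup M] [Module (AdjoinUnit A) M] :
    Projective (ModuleCat.of (AdjoinUnit A) (ProjCover (A := A) M)) := by
  rw [← IsProjective.iff_projective]
  have := fun p : {p : A × M // p.1 * p.1 = p.1 ∧ incl p.1 • p.2 = p.2} =>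
    projective_span p.1.1 p.2.1
  infer_instance

theorem projCover_unitary (M : Type u) [AddCommGroup M] [Module (AdjoinUnit A) M] :
    isUnitary A (ModuleCat.of (AdjoinUnit A) (ProjCover (A := A) M)) := by
  rw [isUnitary, eq_top_iff]
  intro x _
  classical
  change ProjCover M at x
  induction x using DirectSum.induction_on with
  | zero => exact zero_mem _
  | add x y hx hy => exact add_mem (hx trivial) (hy trivial)
  | of i x =>
    obtain ⟨x, hx⟩ := x
    obtain ⟨y, rfl⟩ := Submodule.mem_span_singleton.1 hx
    obtain ⟨b, hb⟩ := exists_incl_eq_mul y i.1.1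
    obtain ⟨e, he, heb, -⟩ := HasLeftLocalUnits.exists_unit b b
    refine AddSubgroup.subset_closure ⟨e, DirectSum.of
      (fun p : {p : A × M // p.1 * p.1 = p.1 ∧ incl p.1 • p.2 = p.2} =>
        Submodule.span (AdjoinUnit A) {incl p.1.1}) i ⟨_, hx⟩, ?_⟩
    refine Eq.trans ?_ ((DirectSum.lof (AdjoinUnit A) _ (fun p :
      {p : A × M // p.1 * p.1 = p.1 ∧ incl p.1 • p.2 = p.2} =>
        Submodule.span (AdjoinUnit A) {incl p.1.1}) i).map_smul (incl e) ⟨_, hx⟩)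
    change DirectSum.lof (AdjoinUnit A) _ _ i _ = _
    congr 1
    refine Subtype.ext ?_
    change y * incl i.1.1 = incl e * (y * incl i.1.1)
    rw [← hb, ← map_mul, heb]

open scoped Classical in
/-- The map `A e → M`, `x ↦ x m` on the summand with index `(e, m)`. -/
noncomputable def projCoverMap (M : Type u) [AddCommGroup M] [Module (AdjoinUnit A) M] :
    ProjCover (A := A) M →ₗ[AdjoinUnit A] M :=
  DirectSum.toModule _ _ _ fun p =>
    (LinearMap.toSpanSingleton (AdjoinUnit A) M p.1.2).comp (Submodule.subtype _)

instance : EnoughProjectives (UnitaryMod A) where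
  presentation M := by
    classical
    have := ObjectProperty.preservesEpimorphisms_ι_of_isNormalMonoCategory (isUnitary A)
    let P : UnitaryMod A := ⟨_, projCover_unitary (A := A) M.obj⟩
    have hP : Projective P.obj := projCover_projective (A := A) M.obj
    have hP' : Projective P := by
      refine Projective.mk (fun {E X} f e he => ?_)
      have : Epi e.hom := inferInstanceAs (Epi ((isUnitary A).ι.map e))
      exact ⟨ObjectProperty.homMk (Projective.factorThru f.hom e.hom),
        ObjectProperty.hom_ext _ (Projective.factorThru_comp _ _)⟩
    let π : P ⟶ M := ObjectProperty.homMk (ModuleCat.ofHom (projCoverMap M.obj))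
    have hπ : Epi π := by
      refine (isUnitary A).ι.epi_of_epi_map ((ModuleCat.epi_iff_surjective _).2 fun m => ?_)
      obtain ⟨e, he, h⟩ := (isUnitary_iff _).1 M.property m
      refine ⟨DirectSum.lof (AdjoinUnit A) _ (fun p :
        {p : A × M.obj // p.1 * p.1 = p.1 ∧ incl p.1 • p.2 = p.2} =>
        Submodule.span (AdjoinUnit A) {incl p.1.1}) ⟨(e, m), he, h⟩
          ⟨incl e, Submodule.mem_span_singleton_self _⟩, ?_⟩
      refine (DirectSum.toModule_lof _ _ _).trans ?_
      exact h
    exact ⟨{ p := P, projective := hP', f := π, epi := hπ }⟩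

end Modules

section Tensor

open TensorProduct

variable (S : Type u) [Ring S]

/-- The subgroup of `N ⊗_ℤ M` generated by the elements `n s ⊗ m - n ⊗ s m`. -/
def balancedRel (N M : Type u) [AddCommGroup N] [Module Sᵐᵒᵖ N] [AddCommGroup M] [Module S M] :
    AddSubgroup (N ⊗[ℤ] M) :=
  AddSubgroup.closure {t | ∃ (n : N) (s : S) (m : M),
    t = (MulOpposite.op s • n) ⊗ₜ[ℤ] m - n ⊗ₜ[ℤ] (s • m)}

/-- The tensor product `N ⊗_S M` of a right module and a left module over a (not necessarily
commutative) ring: the quotient of `N ⊗_ℤ M` by the relations `n s ⊗ m = n ⊗ s m`. -/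
abbrev BalancedTensor (N M : Type u) [AddCommGroup N] [Module Sᵐᵒᵖ N] [AddCommGroup M]
    [Module S M] : Type u :=
  (N ⊗[ℤ] M) ⧸ balancedRel S N M

variable (N : Type u) [AddCommGroup N] [Module Sᵐᵒᵖ N]

/-- The map `N ⊗_S M → N ⊗_S M'`, `n ⊗ m ↦ n ⊗ f m`. -/
def BalancedTensor.map {M M' : Type u} [AddCommGroup M] [AddCommGroup M'] [Module S M]
    [Module S M'] (f : M →ₗ[S] M') : BalancedTensor S N M →+ BalancedTensor S N M' :=
  QuotientAddGroup.map _ _ (f.toAddMonoidHom.toIntLinearMap.lTensor N).toAddMonoidHom (by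
    rw [balancedRel, AddSubgroup.closure_le]
    rintro _ ⟨n, s, m, rfl⟩
    refine AddSubgroup.subset_closure ⟨n, s, f m, ?_⟩
    rw [map_sub, ← f.map_smul]
    rfl)

theorem BalancedTensor.hom_ext {M B : Type u} [AddCommGroup M] [Module S M] [AddCommGroup B]
    {f g : BalancedTensor S N M →+ B}
    (h : ∀ (n : N) (m : M), f (QuotientAddGroup.mk (n ⊗ₜ[ℤ] m)) =
      g (QuotientAddGroup.mk (n ⊗ₜ[ℤ] m))) : f = g := by
  refine QuotientAddGroup.addMonoidHom_ext _ (AddMonoidHom.ext fun t => ?_)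
  induction t using TensorProduct.induction_on with
  | zero => rw [map_zero, map_zero]
  | tmul n m => exact h n m
  | add x y hx hy => rw [map_add, map_add, hx, hy]

/-- The functor `N ⊗_S -` from left `S`-modules to abelian groups. -/
def tensorFunctor : ModuleCat.{u} S ⥤ AddCommGrpCat.{u} where
  obj M := AddCommGrpCat.of (BalancedTensor S N M)
  map f := AddCommGrpCat.ofHom (BalancedTensor.map S N f.hom)
  map_id _ := AddCommGrpCat.hom_ext (BalancedTensor.hom_ext S N fun _ _ => rfl)
  map_comp _ _ := AddCommGrpCat.hom_ext (BalancedTensor.hom_ext S N fun _ _ => rfl)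

instance : (tensorFunctor S N).Additive where
  map_add {_ _ f g} := AddCommGrpCat.hom_ext (BalancedTensor.hom_ext S N fun n m =>
    congrArg QuotientAddGroup.mk (TensorProduct.tmul_add n (f.hom m) (g.hom m)))

end Tensor

section RightModules

variable {A : Type u} [NonUnitalRing A] {N : Type u} [AddCommGroup N]

/-- A biadditive associative right action `ρ` of `A` on `N` makes `N` a right module over `ℤ ⊕ A`,
with `n (k + a) = k n + n a`. -/
abbrev rightModule (ρ : N →+ A →+ N) (h : ∀ n a b, ρ n (a * b) = ρ (ρ n a) b) :
    Module (AdjoinUnit A)ᵐᵒᵖ N where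
  smul s n := s.unop.toProd.1 • n + ρ n s.unop.toProd.2
  one_smul n := by
    change (1 : ℤ) • n + ρ n 0 = n
    rw [map_zero, one_smul, add_zero]
  mul_smul s t n := by
    change (t.unop.toProd.1 * s.unop.toProd.1) • n +
        ρ n (t.unop.toProd.1 • s.unop.toProd.2 + s.unop.toProd.1 • t.unop.toProd.2 +
          t.unop.toProd.2 * s.unop.toProd.2) =
      s.unop.toProd.1 • (t.unop.toProd.1 • n + ρ n t.unop.toProd.2) +
        ρ (t.unop.toProd.1 • n + ρ n t.unop.toProd.2) s.unop.toProd.2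
    simp only [map_add, map_zsmul, h, AddMonoidHom.add_apply, AddMonoidHom.smul_apply, smul_add,
      smul_smul]
    rw [mul_comm t.unop.toProd.1]
    abel
  smul_zero s := by
    change s.unop.toProd.1 • (0 : N) + ρ 0 s.unop.toProd.2 = 0
    rw [map_zero, smul_zero, AddMonoidHom.zero_apply, add_zero]
  smul_add s n n' := by
    change s.unop.toProd.1 • (n + n') + ρ (n + n') s.unop.toProd.2 =
      (s.unop.toProd.1 • n + ρ n s.unop.toProd.2) + (s.unop.toProd.1 • n' + ρ n' s.unop.toProd.2)
    rw [map_add, smul_add, AddMonoidHom.add_apply]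
    abel
  add_smul s t n := by
    change (s.unop.toProd.1 + t.unop.toProd.1) • n + ρ n (s.unop.toProd.2 + t.unop.toProd.2) =
      (s.unop.toProd.1 • n + ρ n s.unop.toProd.2) + (t.unop.toProd.1 • n + ρ n t.unop.toProd.2)
    rw [map_add, add_smul]
    abel
  zero_smul n := by
    change (0 : ℤ) • n + ρ n 0 = 0
    rw [map_zero, zero_smul, add_zero]

end RightModules

section Tor

variable (A : Type u) [NonUnitalRing A] [HasLeftLocalUnits A]
  (N : Type u) [AddCommGroup N] [Module (AdjoinUnit A)ᵐᵒᵖ N]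

/-- `Tor_n^A(N, M)` for a right `A`-module `N` and a unitary left `A`-module `M`: the value at `M`
of the `n`-th left derived functor of `N ⊗_A -` on the category of unitary left `A`-modules.
Balancing over `ℤ ⊕ A` is the same as balancing over `A`, as integers move across `⊗_ℤ` anyway. -/
noncomputable def Tor (n : ℕ) (M : UnitaryMod A) : AddCommGrpCat.{u} :=
  (((isUnitary A).ι ⋙ tensorFunctor (AdjoinUnit A) N).leftDerived n).obj M

end Tor

section Groupoids

/-- A topological groupoid with space of arrows `G` and space of units `X`. The product `g h` is
defined when the source of `g` is the range of `h`. The unit space is identified with a subspace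
of `G` by the continuous injection `one`. -/
structure TopGroupoid (X G : Type u) [TopologicalSpace X] [TopologicalSpace G] where
  src : G → X
  rng : G → X
  one : X → G
  inv : G → G
  mul : (g h : G) → src g = rng h → G
  src_one : ∀ x, src (one x) = x
  rng_one : ∀ x, rng (one x) = x
  src_inv : ∀ g, src (inv g) = rng g
  rng_inv : ∀ g, rng (inv g) = src g
  src_mul : ∀ g h hgh, src (mul g h hgh) = src h
  rng_mul : ∀ g h hgh, rng (mul g h hgh) = rng g
  mul_assoc : ∀ g h k (hgh : src g = rng h) (hhk : src h = rng k),
    mul (mul g h hgh) k ((src_mul g h hgh).trans hhk) =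
      mul g (mul h k hhk) (hgh.trans (rng_mul h k hhk).symm)
  one_mul : ∀ g, mul (one (rng g)) g (src_one _) = g
  mul_one : ∀ g, mul g (one (src g)) (rng_one _).symm = g
  inv_mul : ∀ g, mul (inv g) g (src_inv g) = one (src g)
  mul_inv : ∀ g, mul g (inv g) (rng_inv g).symm = one (rng g)
  continuous_src : Continuous src
  continuous_rng : Continuous rng
  continuous_one : Continuous one
  continuous_inv : Continuous inv
  continuous_mul : Continuous fun p : {p : G × G // src p.1 = rng p.2} => mul p.1.1 p.1.2 p.2

variable {X G : Type u} [TopologicalSpace X] [TopologicalSpace G]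

/-- A topological groupoid is ample if its unit space is locally compact, Hausdorff and totally
disconnected and its source map is a local homeomorphism. The space of arrows need not be
Hausdorff. -/
class TopGroupoid.IsAmple (𝓖 : TopGroupoid X G) : Prop where
  locallyCompact : LocallyCompactSpace X
  t2 : T2Space X
  totallyDisconnected : TotallyDisconnectedSpace X
  src_localHomeo : IsLocalHomeomorph 𝓖.src

/-- A subgroupoid, given by its set of arrows: a set of arrows closed under products and inverses.
It need not contain all units. -/
structure TopGroupoid.IsSubgroupoid (𝓖 : TopGroupoid X G) (H : Set G) : Prop where
  mul_mem : ∀ g ∈ H, ∀ h ∈ H, ∀ hgh, 𝓖.mul g h hgh ∈ H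
  inv_mem : ∀ g ∈ H, 𝓖.inv g ∈ H

/-- A subgroupoid is principal if it has trivial isotropy. -/
def TopGroupoid.IsPrincipalOn (𝓖 : TopGroupoid X G) (H : Set G) : Prop :=
  ∀ g ∈ H, 𝓖.src g = 𝓖.rng g → g = 𝓖.one (𝓖.src g)

/-- A set which is compact (i.e. quasi-compact and Hausdorff) and open. -/
structure IsCompactOpen {Y : Type u} [TopologicalSpace Y] (U : Set Y) : Prop where
  isCompact : IsCompact U
  t2 : T2Space U
  isOpen : IsOpen U

/-- A groupoid is AF if it is a directed union of compact open principal subgroupoids. -/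
def TopGroupoid.IsAF (𝓖 : TopGroupoid X G) : Prop :=
  ∃ S : Set (Set G), S.Nonempty ∧ DirectedOn (· ⊆ ·) S ∧ ⋃₀ S = Set.univ ∧
    ∀ H ∈ S, 𝓖.IsSubgroupoid H ∧ IsCompactOpen H ∧ 𝓖.IsPrincipalOn H

/-- The group `ℤY` of functions `Y → ℤ` generated by the characteristic functions of the compact
open subsets of `Y`. -/
def compactOpenFun (Y : Type u) [TopologicalSpace Y] : AddSubgroup (Y → ℤ) :=
  AddSubgroup.closure {f | ∃ U : Set Y, IsCompactOpen U ∧ f = U.indicator 1}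

namespace TopGroupoid

variable (𝓖 : TopGroupoid X G)

/-- The convolution product `(f * h)(g) = ∑ f(a) h(a⁻¹ g)`, the sum being over all arrows `a` with
the same range as `g`. -/
noncomputable def conv (f h : G → ℤ) (g : G) : ℤ :=
  ∑ᶠ a : {a : G // 𝓖.rng a = 𝓖.rng g},
    f a * h (𝓖.mul (𝓖.inv a) g ((𝓖.src_inv _).trans a.2))

/-- The right action `(h f)(x) = ∑ h(r(g)) f(g)` of functions on `G` on functions on the unit
space, the sum being over all arrows `g` with source `x`. -/
noncomputable def act (h : X → ℤ) (f : G → ℤ) (x : X) : ℤ :=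
  ∑ᶠ g : {g : G // 𝓖.src g = x}, h (𝓖.rng g) * f g

/-- The compact bisections. -/
structure IsCompactBisection (B : Set G) : Prop where
  isCompact : IsCompact B
  isOpen : IsOpen B
  src_inj : Set.InjOn 𝓖.src B
  rng_inj : Set.InjOn 𝓖.rng B

theorem inv_inv (g : G) : 𝓖.inv (𝓖.inv g) = g := by
  have h1 := 𝓖.mul_assoc (𝓖.inv (𝓖.inv g)) (𝓖.inv g) g (𝓖.src_inv _) (𝓖.src_inv _)
  simp only [𝓖.inv_mul] at h1
  have h2 := 𝓖.mul_one (𝓖.inv (𝓖.inv g))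
  have h3 := 𝓖.one_mul g
  simp only [𝓖.src_inv, 𝓖.rng_inv] at h1 h2
  rw [h3, h2] at h1
  exact h1.symm

theorem inv_mul_cancel_left (a b : G) (h : 𝓖.src a = 𝓖.rng b) (h') :
    𝓖.mul (𝓖.inv a) (𝓖.mul a b h) h' = b := by
  rw [← 𝓖.mul_assoc (𝓖.inv a) a b (𝓖.src_inv a) h]
  simp only [𝓖.inv_mul, h, 𝓖.one_mul]

theorem mul_inv_cancel_left (a g : G) (h : 𝓖.rng a = 𝓖.rng g) (h1) (h2) :
    𝓖.mul a (𝓖.mul (𝓖.inv a) g h1) h2 = g := by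
  rw [← 𝓖.mul_assoc a (𝓖.inv a) g (𝓖.rng_inv a).symm h1]
  simp only [𝓖.mul_inv, h, 𝓖.one_mul]

/-- The product of two sets of arrows. -/
def mulSet (U V : Set G) : Set G :=
  {g | ∃ a ∈ U, ∃ b ∈ V, ∃ h : 𝓖.src a = 𝓖.rng b, 𝓖.mul a b h = g}

theorem mulSet_assoc (U V W : Set G) :
    𝓖.mulSet (𝓖.mulSet U V) W = 𝓖.mulSet U (𝓖.mulSet V W) := by
  ext g
  constructor
  · rintro ⟨_, ⟨a, ha, b, hb, h, rfl⟩, c, hc, h', rfl⟩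
    have hbc := (𝓖.src_mul a b h).symm.trans h'
    exact ⟨a, ha, _, ⟨b, hb, c, hc, hbc, rfl⟩, h.trans (𝓖.rng_mul _ _ _).symm,
      (𝓖.mul_assoc _ _ _ _ _).symm⟩
  · rintro ⟨a, ha, _, ⟨b, hb, c, hc, h, rfl⟩, h', rfl⟩
    have hab := h'.trans (𝓖.rng_mul b c h)
    exact ⟨_, ⟨a, ha, b, hb, hab, rfl⟩, c, hc, (𝓖.src_mul _ _ _).trans h, 𝓖.mul_assoc _ _ _ _ _⟩

variable {𝓖} in
theorem IsCompactBisection.subset {B C : Set G} (hB : 𝓖.IsCompactBisection B)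
    (hC : IsCompact C) (hC' : IsOpen C) (h : C ⊆ B) : 𝓖.IsCompactBisection C :=
  ⟨hC, hC', hB.src_inj.mono h, hB.rng_inj.mono h⟩

theorem conv_neg_left (f h : G → ℤ) : 𝓖.conv (-f) h = -𝓖.conv f h := by
  funext g
  refine Eq.trans ?_ (finsum_neg_distrib _)
  exact finsum_congr fun a => neg_mul _ _

theorem conv_neg_right (f h : G → ℤ) : 𝓖.conv f (-h) = -𝓖.conv f h := by
  funext g
  refine Eq.trans ?_ (finsum_neg_distrib _)
  exact finsum_congr fun a => mul_neg _ _

theorem conv_zero_left (h : G → ℤ) : 𝓖.conv 0 h = 0 := by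
  funext g
  exact (finsum_congr fun a => zero_mul _).trans finsum_zero

theorem conv_zero_right (f : G → ℤ) : 𝓖.conv f 0 = 0 := by
  funext g
  exact (finsum_congr fun a => mul_zero _).trans finsum_zero

theorem act_neg_left (h : X → ℤ) (f : G → ℤ) : 𝓖.act (-h) f = -𝓖.act h f := by
  funext x
  refine Eq.trans ?_ (finsum_neg_distrib _)
  exact finsum_congr fun a => neg_mul _ _

theorem act_neg_right (h : X → ℤ) (f : G → ℤ) : 𝓖.act h (-f) = -𝓖.act h f := by
  funext x
  refine Eq.trans ?_ (finsum_neg_distrib _)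
  exact finsum_congr fun a => mul_neg _ _

theorem act_zero_left (f : G → ℤ) : 𝓖.act 0 f = 0 := by
  funext x
  exact (finsum_congr fun a => zero_mul _).trans finsum_zero

theorem act_zero_right (h : X → ℤ) : 𝓖.act h 0 = 0 := by
  funext x
  exact (finsum_congr fun a => mul_zero _).trans finsum_zero

theorem conv_indicator {U : Set G} (hU : Set.InjOn 𝓖.rng U) (V : Set G) :
    𝓖.conv (U.indicator 1) (V.indicator 1) = (𝓖.mulSet U V).indicator 1 := by
  classical
  funext g
  by_cases hg : g ∈ 𝓖.mulSet U V
  · rw [Set.indicator_of_mem hg]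
    obtain ⟨a, ha, b, hb, h, rfl⟩ := hg
    refine (finsum_eq_single _ ⟨a, (𝓖.rng_mul a b h).symm⟩ fun c hc => ?_).trans ?_
    · rw [Set.indicator_of_notMem, zero_mul]
      exact fun hcU => hc (Subtype.ext (hU hcU ha (c.2.trans (𝓖.rng_mul a b h))))
    · simp only [inv_mul_cancel_left]
      rw [Set.indicator_of_mem ha, Set.indicator_of_mem hb]
      rfl
  · rw [Set.indicator_of_notMem hg]
    refine (finsum_congr fun a => ?_).trans finsum_zero
    by_contra hne
    have h1 := Set.mem_of_indicator_ne_zero (left_ne_zero_of_mul hne)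
    have h2 := Set.mem_of_indicator_ne_zero (right_ne_zero_of_mul hne)
    exact hg ⟨_, h1, _, h2, ((𝓖.rng_mul _ _ _).trans (𝓖.rng_inv _)).symm,
      𝓖.mul_inv_cancel_left _ _ a.2 _ _⟩

theorem act_indicator (K : Set X) {B : Set G} (hB : Set.InjOn 𝓖.src B) :
    𝓖.act (K.indicator 1) (B.indicator 1) = (𝓖.src '' (B ∩ 𝓖.rng ⁻¹' K)).indicator 1 := by
  classical
  funext x
  by_cases hx : x ∈ 𝓖.src '' (B ∩ 𝓖.rng ⁻¹' K)
  · rw [Set.indicator_of_mem hx]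
    obtain ⟨a, ⟨ha, haK⟩, rfl⟩ := hx
    refine (finsum_eq_single _ ⟨a, rfl⟩ fun c hc => ?_).trans ?_
    · rw [Set.indicator_of_notMem (a := c.1), mul_zero]
      exact fun hcU => hc (Subtype.ext (hB hcU ha c.2))
    · rw [Set.indicator_of_mem ha, Set.indicator_of_mem (show 𝓖.rng a ∈ K from haK)]
      rfl
  · rw [Set.indicator_of_notMem hx]
    refine (finsum_congr fun a => ?_).trans finsum_zero
    by_contra hne
    have h1 := Set.mem_of_indicator_ne_zero (left_ne_zero_of_mul hne)
    have h2 := Set.mem_of_indicator_ne_zero (right_ne_zero_of_mul hne)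
    exact hx ⟨_, ⟨h2, h1⟩, a.2⟩

theorem src_image_mulSet (K : Set X) (B C : Set G) :
    𝓖.src '' (C ∩ 𝓖.rng ⁻¹' (𝓖.src '' (B ∩ 𝓖.rng ⁻¹' K))) =
      𝓖.src '' (𝓖.mulSet B C ∩ 𝓖.rng ⁻¹' K) := by
  ext x
  constructor
  · rintro ⟨c, ⟨hc, b, ⟨hb, hbK⟩, h⟩, rfl⟩
    refine ⟨𝓖.mul b c h, ⟨⟨b, hb, c, hc, h, rfl⟩, ?_⟩, 𝓖.src_mul _ _ _⟩
    rw [Set.mem_preimage, 𝓖.rng_mul]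
    exact hbK
  · rintro ⟨_, ⟨⟨b, hb, c, hc, h, rfl⟩, hK⟩, rfl⟩
    rw [Set.mem_preimage, 𝓖.rng_mul] at hK
    exact ⟨c, ⟨hc, b, ⟨hb, hK⟩, h⟩, (𝓖.src_mul _ _ _).symm⟩

theorem conv_one {K : Set X} {f : G → ℤ} (h : ∀ g, f g ≠ 0 → 𝓖.rng g ∈ K) :
    𝓖.conv ((𝓖.one '' K).indicator 1) f = f := by
  classical
  funext g
  refine (finsum_eq_single _ ⟨𝓖.one (𝓖.rng g), 𝓖.rng_one _⟩ fun c hc => ?_).trans ?_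
  · rw [Set.indicator_of_notMem, zero_mul]
    rintro ⟨x, -, hx⟩
    refine hc (Subtype.ext ?_)
    have h2 := c.2
    rw [← hx, 𝓖.rng_one] at h2
    rw [← hx, h2]
  · have h1 : 𝓖.inv (𝓖.one (𝓖.rng g)) = 𝓖.one (𝓖.rng g) := by
      have h2 := 𝓖.mul_one (𝓖.inv (𝓖.one (𝓖.rng g)))
      have h3 := 𝓖.inv_mul (𝓖.one (𝓖.rng g))
      simp only [𝓖.src_inv, 𝓖.rng_one, 𝓖.src_one] at h2 h3
      exact h2.symm.trans h3
    simp only [h1, 𝓖.one_mul]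
    by_cases hg : f g = 0
    · rw [hg, mul_zero]
    · rw [Set.indicator_of_mem (Set.mem_image_of_mem _ (h g hg))]
      exact _root_.one_mul _

section Ample

variable [𝓖.IsAmple]

theorem rng_localHomeo : IsLocalHomeomorph 𝓖.rng := by
  have h : 𝓖.rng = 𝓖.src ∘ 𝓖.inv := funext fun g => (𝓖.src_inv g).symm
  let e : G ≃ₜ G := ⟨⟨𝓖.inv, 𝓖.inv, 𝓖.inv_inv, 𝓖.inv_inv⟩, 𝓖.continuous_inv, 𝓖.continuous_inv⟩
  rw [h]
  exact IsAmple.src_localHomeo.comp e.isLocalHomeomorph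

theorem one_localHomeo : IsLocalHomeomorph 𝓖.one := by
  have h : IsLocalHomeomorph (𝓖.src ∘ 𝓖.one) := by
    rw [show 𝓖.src ∘ 𝓖.one = id from funext 𝓖.src_one]
    exact (Homeomorph.refl X).isLocalHomeomorph
  exact h.of_comp IsAmple.src_localHomeo 𝓖.continuous_one

variable {𝓖} in
theorem IsCompactBisection.isCompactOpen {B : Set G} (hB : 𝓖.IsCompactBisection B) :
    IsCompactOpen B := by
  have : T2Space X := IsAmple.t2 𝓖
  exact ⟨hB.isCompact, T2Space.of_injective_continuous (Set.injOn_iff_injective.1 hB.src_inj)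
    (𝓖.continuous_src.comp continuous_subtype_val), hB.isOpen⟩

theorem exists_compactOpen_unit (𝓖 : TopGroupoid X G) [𝓖.IsAmple] {x : X} {V : Set X} (hV : IsOpen V) (hx : x ∈ V) :
    ∃ K : Set X, IsCompact K ∧ IsOpen K ∧ x ∈ K ∧ K ⊆ V := by
  have := IsAmple.locallyCompact 𝓖
  have := IsAmple.t2 𝓖
  have := IsAmple.totallyDisconnected 𝓖
  obtain ⟨C, hC, hxC, hCV⟩ := exists_compact_subset hV hx
  obtain ⟨K, hK, hxK, hKC⟩ := (loc_compact_Haus_tot_disc_of_zero_dim (H := X)).exists_subset_of_mem_open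
    hxC isOpen_interior
  exact ⟨K, hC.of_isClosed_subset hK.1 (hKC.trans interior_subset), hK.2, hxK,
    (hKC.trans interior_subset).trans hCV⟩

theorem exists_bisection {g : G} {W : Set G} (hW : IsOpen W) (hg : g ∈ W) :
    ∃ B, 𝓖.IsCompactBisection B ∧ g ∈ B ∧ B ⊆ W := by
  obtain ⟨e, hge, he⟩ := (IsAmple.src_localHomeo (𝓖 := 𝓖)) g
  obtain ⟨e', hge', he'⟩ := 𝓖.rng_localHomeo g
  have hO : IsOpen (e.source ∩ (e'.source ∩ W)) := e.open_source.inter (e'.open_source.inter hW)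
  have hsrc : IsOpenMap 𝓖.src := (IsAmple.src_localHomeo (𝓖 := 𝓖)).isOpenMap
  obtain ⟨K, hKc, hKo, hgK, hK⟩ := 𝓖.exists_compactOpen_unit (hsrc _ hO)
    (Set.mem_image_of_mem _ ⟨hge, hge', hg⟩)
  have hinj : Set.InjOn 𝓖.src (e.source ∩ (e'.source ∩ W)) := by
    rw [he]; exact e.injOn.mono Set.inter_subset_left
  refine ⟨(e.source ∩ (e'.source ∩ W)) ∩ 𝓖.src ⁻¹' K, ⟨?_, ?_, ?_, ?_⟩, ?_, ?_⟩
  · have : (e.source ∩ (e'.source ∩ W)) ∩ 𝓖.src ⁻¹' K = e.symm '' K := by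
      ext a
      constructor
      · rintro ⟨ha, haK⟩
        refine ⟨_, haK, ?_⟩
        rw [he]; exact e.left_inv ha.1
      · rintro ⟨x, hx, rfl⟩
        obtain ⟨a, ha, rfl⟩ := hK hx
        have : e.symm (𝓖.src a) = a := by rw [he]; exact e.left_inv ha.1
        rw [this]
        exact ⟨ha, hx⟩
    rw [this]
    refine hKc.image_of_continuousOn (e.continuousOn_symm.mono fun x hx => ?_)
    obtain ⟨a, ha, rfl⟩ := hK hx
    rw [he]; exact e.map_source ha.1
  · exact hO.inter (hKo.preimage 𝓖.continuous_src)
  · exact hinj.mono Set.inter_subset_left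
  · rw [he']; exact e'.injOn.mono fun a ha => ha.1.2.1
  · exact ⟨⟨hge, hge', hg⟩, hgK⟩
  · exact fun a ha => ha.1.2.2

/-- The characteristic function of a compact open set is a sum of characteristic functions of
compact bisections. -/
theorem indicator_mem_closure {U : Set G} (hU : IsCompactOpen U) :
    U.indicator (1 : G → ℤ) ∈
      AddSubgroup.closure {f : G → ℤ | ∃ B, 𝓖.IsCompactBisection B ∧ f = B.indicator 1} := by
  classical
  choose! B hB hgB hBU using fun g (hg : g ∈ U) => 𝓖.exists_bisection hU.isOpen hg
  obtain ⟨t, ht, htU⟩ := hU.isCompact.elim_nhds_subcover B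
    fun g hg => (hB g hg).isOpen.mem_nhds (hgB g hg)
  have key : ∀ s : Finset G, (∀ g ∈ s, g ∈ U) → (⋃ g ∈ s, B g).indicator (1 : G → ℤ) ∈
      AddSubgroup.closure {f : G → ℤ | ∃ B, 𝓖.IsCompactBisection B ∧ f = B.indicator 1} := by
    intro s
    induction s using Finset.induction_on with
    | empty => intro _; simp; exact zero_mem _
    | insert a s ha ih =>
      intro hs
      have hsU : ∀ g ∈ s, g ∈ U := fun g hg => hs g (Finset.mem_insert_of_mem hg)
      have haU : a ∈ U := hs a (Finset.mem_insert_self a s)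
      set W := ⋃ g ∈ s, B g with hW
      have hWo : IsOpen W := isOpen_biUnion fun g hg => (hB g (hsU g hg)).isOpen
      have hWc : IsCompact W := s.isCompact_biUnion fun g hg => (hB g (hsU g hg)).isCompact
      have hWU : W ⊆ U := Set.iUnion₂_subset fun g hg => hBU g (hsU g hg)
      have := hU.t2
      have hWcl : IsClosed ((↑) ⁻¹' W : Set U) := by
        refine IsCompact.isClosed ?_
        rw [Subtype.isCompact_iff, Subtype.image_preimage_coe, Set.inter_eq_right.2 hWU]
        exact hWc
      have hd : IsOpen (B a \ W) := by
        have h1 := hU.isOpen.isOpenMap_subtype_val _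
          (((hB a haU).isOpen.preimage continuous_subtype_val).inter hWcl.isOpen_compl)
        convert h1 using 1
        ext g
        constructor
        · exact fun hg => ⟨⟨g, hBU a haU hg.1⟩, ⟨hg.1, hg.2⟩, rfl⟩
        · rintro ⟨g, hg, rfl⟩
          exact hg
      have hbis := (hB a haU).subset ((hB a haU).isCompact.diff hWo) hd Set.sdiff_subset
      have : (⋃ g ∈ insert a s, B g).indicator (1 : G → ℤ) =
          (B a \ W).indicator 1 + W.indicator 1 := by
        rw [Finset.set_biUnion_insert, ← hW, ← Set.sdiff_union_self,
          Set.indicator_union_of_disjoint Set.disjoint_sdiff_left]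
        rfl
      rw [this]
      exact add_mem (AddSubgroup.subset_closure ⟨_, hbis, rfl⟩) (ih hsU)
  have : U = ⋃ g ∈ t, B g :=
    htU.antisymm (Set.iUnion₂_subset fun g hg => hBU g (ht g hg))
  rw [this]
  exact key t ht

theorem compactOpenFun_eq : compactOpenFun G =
    AddSubgroup.closure {f : G → ℤ | ∃ B, 𝓖.IsCompactBisection B ∧ f = B.indicator 1} := by
  refine le_antisymm ((AddSubgroup.closure_le _).2 ?_) (AddSubgroup.closure_mono ?_)
  · rintro _ ⟨U, hU, rfl⟩
    exact 𝓖.indicator_mem_closure hU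
  · rintro _ ⟨B, hB, rfl⟩
    exact ⟨B, hB.isCompactOpen, rfl⟩

theorem compactOpenFun_induction {p : (G → ℤ) → Prop}
    (ind : ∀ B, 𝓖.IsCompactBisection B → p (B.indicator 1)) (zero : p 0)
    (add : ∀ f h, f ∈ compactOpenFun G → h ∈ compactOpenFun G → p f → p h → p (f + h))
    (neg : ∀ f, f ∈ compactOpenFun G → p f → p (-f)) {f : G → ℤ} (hf : f ∈ compactOpenFun G) :
    p f := by
  rw [𝓖.compactOpenFun_eq] at hf add neg
  induction hf using AddSubgroup.closure_induction with
  | mem f hf => obtain ⟨B, hB, rfl⟩ := hf; exact ind B hB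
  | zero => exact zero
  | add f h hf hh ihf ihh => exact add f h hf hh ihf ihh
  | neg f hf ihf => exact neg f hf ihf

theorem indicator_mem {B : Set G} (hB : 𝓖.IsCompactBisection B) :
    B.indicator 1 ∈ compactOpenFun G :=
  AddSubgroup.subset_closure ⟨B, hB.isCompactOpen, rfl⟩

theorem finite_rng_fiber {f : G → ℤ} (hf : f ∈ compactOpenFun G) (x : X) :
    {a : G | 𝓖.rng a = x ∧ f a ≠ 0}.Finite := by
  refine 𝓖.compactOpenFun_induction
    (p := fun f => {a : G | 𝓖.rng a = x ∧ f a ≠ 0}.Finite) ?_ ?_ ?_ ?_ hf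
  · intro B hB
    refine Set.Subsingleton.finite fun a ha b hb => ?_
    exact hB.rng_inj (Set.mem_of_indicator_ne_zero ha.2) (Set.mem_of_indicator_ne_zero hb.2)
      (ha.1.trans hb.1.symm)
  · simp
  · intro f h _ _ hf hh
    refine (hf.union hh).subset fun a ha => ?_
    by_contra hn
    simp only [Set.mem_union, Set.mem_ofPred_eq, not_or, not_and, not_not] at hn
    exact ha.2 (by simp [hn.1 ha.1, hn.2 ha.1])
  · intro f _ hf
    simpa using hf

theorem finite_src_fiber {f : G → ℤ} (hf : f ∈ compactOpenFun G) (x : X) :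
    {a : G | 𝓖.src a = x ∧ f a ≠ 0}.Finite := by
  refine 𝓖.compactOpenFun_induction
    (p := fun f => {a : G | 𝓖.src a = x ∧ f a ≠ 0}.Finite) ?_ ?_ ?_ ?_ hf
  · intro B hB
    refine Set.Subsingleton.finite fun a ha b hb => ?_
    exact hB.src_inj (Set.mem_of_indicator_ne_zero ha.2) (Set.mem_of_indicator_ne_zero hb.2)
      (ha.1.trans hb.1.symm)
  · simp
  · intro f h _ _ hf hh
    refine (hf.union hh).subset fun a ha => ?_
    by_contra hn
    simp only [Set.mem_union, Set.mem_ofPred_eq, not_or, not_and, not_not] at hn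
    exact ha.2 (by simp [hn.1 ha.1, hn.2 ha.1])
  · intro f _ hf
    simpa using hf

theorem conv_support {f : G → ℤ} (hf : f ∈ compactOpenFun G) (h : G → ℤ) (g : G) :
    (Function.support fun a : {a : G // 𝓖.rng a = 𝓖.rng g} =>
      f a * h (𝓖.mul (𝓖.inv a) g ((𝓖.src_inv _).trans a.2))).Finite := by
  refine Set.Finite.subset (Set.Finite.preimage Subtype.val_injective.injOn
    (𝓖.finite_rng_fiber hf (𝓖.rng g))) fun a ha => ⟨a.2, left_ne_zero_of_mul ha⟩

theorem act_support (h : X → ℤ) {f : G → ℤ} (hf : f ∈ compactOpenFun G) (x : X) :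
    (Function.support fun g : {g : G // 𝓖.src g = x} => h (𝓖.rng g) * f g).Finite := by
  refine Set.Finite.subset (Set.Finite.preimage Subtype.val_injective.injOn
    (𝓖.finite_src_fiber hf x)) fun a ha => ⟨a.2, right_ne_zero_of_mul ha⟩

theorem conv_add_left {f f' : G → ℤ} (hf : f ∈ compactOpenFun G) (hf' : f' ∈ compactOpenFun G)
    (h : G → ℤ) : 𝓖.conv (f + f') h = 𝓖.conv f h + 𝓖.conv f' h := by
  funext g
  refine Eq.trans ?_ (finsum_add_distrib (𝓖.conv_support hf h g) (𝓖.conv_support hf' h g))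
  exact finsum_congr fun a => add_mul _ _ _

theorem conv_add_right {f : G → ℤ} (hf : f ∈ compactOpenFun G) (h h' : G → ℤ) :
    𝓖.conv f (h + h') = 𝓖.conv f h + 𝓖.conv f h' := by
  funext g
  refine Eq.trans ?_ (finsum_add_distrib (𝓖.conv_support hf h g) (𝓖.conv_support hf h' g))
  exact finsum_congr fun a => mul_add _ _ _

theorem act_add_left (h h' : X → ℤ) {f : G → ℤ} (hf : f ∈ compactOpenFun G) :
    𝓖.act (h + h') f = 𝓖.act h f + 𝓖.act h' f := by
  funext x
  refine Eq.trans ?_ (finsum_add_distrib (𝓖.act_support h hf x) (𝓖.act_support h' hf x))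
  exact finsum_congr fun a => add_mul _ _ _

theorem act_add_right (h : X → ℤ) {f f' : G → ℤ} (hf : f ∈ compactOpenFun G)
    (hf' : f' ∈ compactOpenFun G) : 𝓖.act h (f + f') = 𝓖.act h f + 𝓖.act h f' := by
  funext x
  refine Eq.trans ?_ (finsum_add_distrib (𝓖.act_support h hf x) (𝓖.act_support h hf' x))
  exact finsum_congr fun a => mul_add _ _ _

theorem isOpen_mulSet {U V : Set G} (hU : IsOpen U) (hV : IsOpen V) : IsOpen (𝓖.mulSet U V) := by
  let P := {p : G × G // 𝓖.rng p.1 = 𝓖.rng p.2}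
  let φ : P → G := fun p => 𝓖.mul (𝓖.inv p.1.1) p.1.2 ((𝓖.src_inv _).trans p.2)
  have hφ : Continuous φ := 𝓖.continuous_mul.comp
    (f := fun p : P => (⟨(𝓖.inv p.1.1, p.1.2), (𝓖.src_inv _).trans p.2⟩ :
      {p : G × G // 𝓖.src p.1 = 𝓖.rng p.2}))
    (((𝓖.continuous_inv.comp (continuous_fst.comp continuous_subtype_val)).prodMk
      (continuous_snd.comp continuous_subtype_val)).subtype_mk _)
  have hW : IsOpen {p : P | p.1.1 ∈ U ∧ φ p ∈ V} :=
    (hU.preimage (continuous_fst.comp continuous_subtype_val)).inter (hV.preimage hφ)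
  obtain ⟨O, hO, hOW⟩ := isOpen_induced_iff.1 hW
  rw [isOpen_iff_mem_nhds]
  rintro _ ⟨a, ha, b, hb, h, rfl⟩
  let p : P := ⟨(a, 𝓖.mul a b h), (𝓖.rng_mul a b h).symm⟩
  have hp : p ∈ Subtype.val ⁻¹' O := by
    rw [hOW]
    refine ⟨ha, ?_⟩
    change 𝓖.mul (𝓖.inv a) (𝓖.mul a b h) _ ∈ V
    rw [𝓖.inv_mul_cancel_left]
    exact hb
  obtain ⟨S, T, hS, hT, haS, hbT, hST⟩ := isOpen_prod_iff.1 hO _ _ hp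
  have hN : IsOpen (T ∩ 𝓖.rng ⁻¹' (𝓖.rng '' S)) :=
    hT.inter ((𝓖.rng_localHomeo.isOpenMap _ hS).preimage 𝓖.continuous_rng)
  refine Filter.mem_of_superset (hN.mem_nhds ⟨hbT, a, haS, (𝓖.rng_mul a b h).symm⟩) ?_
  rintro g ⟨hgT, c, hcS, hcg⟩
  have hcg' : (⟨(c, g), hcg⟩ : P) ∈ Subtype.val ⁻¹' O := hST ⟨hcS, hgT⟩
  rw [hOW] at hcg'
  exact ⟨c, hcg'.1, _, hcg'.2, ((𝓖.rng_mul _ _ _).trans (𝓖.rng_inv _)).symm,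
    𝓖.mul_inv_cancel_left _ _ hcg _ _⟩

theorem isCompact_mulSet {U V : Set G} (hU : IsCompact U) (hV : IsCompact V) :
    IsCompact (𝓖.mulSet U V) := by
  have : T2Space X := IsAmple.t2 𝓖
  have hcl : IsClosed {p : G × G | 𝓖.src p.1 = 𝓖.rng p.2} :=
    isClosed_eq (𝓖.continuous_src.comp continuous_fst) (𝓖.continuous_rng.comp continuous_snd)
  have h := (hcl.isClosedEmbedding_subtypeVal.isCompact_preimage (hU.prod hV)).image
    𝓖.continuous_mul
  convert h using 1
  ext g
  constructor
  · rintro ⟨a, ha, b, hb, h, rfl⟩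
    exact ⟨⟨(a, b), h⟩, ⟨ha, hb⟩, rfl⟩
  · rintro ⟨⟨⟨a, b⟩, h⟩, ⟨ha, hb⟩, rfl⟩
    exact ⟨a, ha, b, hb, h, rfl⟩

variable {𝓖} in
theorem IsCompactBisection.mulSet {U V : Set G} (hU : 𝓖.IsCompactBisection U)
    (hV : 𝓖.IsCompactBisection V) : 𝓖.IsCompactBisection (𝓖.mulSet U V) := by
  refine ⟨𝓖.isCompact_mulSet hU.isCompact hV.isCompact, 𝓖.isOpen_mulSet hU.isOpen hV.isOpen, ?_, ?_⟩
  · rintro _ ⟨a, ha, b, hb, h, rfl⟩ _ ⟨a', ha', b', hb', h', rfl⟩ hs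
    rw [𝓖.src_mul, 𝓖.src_mul] at hs
    obtain rfl := hV.src_inj hb hb' hs
    obtain rfl := hU.src_inj ha ha' (h.trans h'.symm)
    rfl
  · rintro _ ⟨a, ha, b, hb, h, rfl⟩ _ ⟨a', ha', b', hb', h', rfl⟩ hs
    rw [𝓖.rng_mul, 𝓖.rng_mul] at hs
    obtain rfl := hU.rng_inj ha ha' hs
    obtain rfl := hV.rng_inj hb hb' (h.symm.trans h')
    rfl

theorem conv_mem {f h : G → ℤ} (hf : f ∈ compactOpenFun G) (hh : h ∈ compactOpenFun G) :
    𝓖.conv f h ∈ compactOpenFun G := by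
  refine 𝓖.compactOpenFun_induction (p := fun f => 𝓖.conv f h ∈ compactOpenFun G)
    (fun U hU => ?_) ?_ (fun f f' hf hf' ih ih' => ?_) (fun f _ ih => ?_) hf
  · refine 𝓖.compactOpenFun_induction
      (p := fun h => 𝓖.conv (U.indicator 1) h ∈ compactOpenFun G)
      (fun V hV => ?_) ?_ (fun h h' _ _ ih ih' => ?_) (fun h _ ih => ?_) hh
    · rw [𝓖.conv_indicator hU.rng_inj]
      exact 𝓖.indicator_mem (hU.mulSet hV)
    · rw [𝓖.conv_zero_right]; exact zero_mem _
    · rw [𝓖.conv_add_right (𝓖.indicator_mem hU)]; exact add_mem ih ih'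
    · rw [𝓖.conv_neg_right]; exact neg_mem ih
  · rw [𝓖.conv_zero_left]; exact zero_mem _
  · rw [𝓖.conv_add_left hf hf']; exact add_mem ih ih'
  · rw [𝓖.conv_neg_left]; exact neg_mem ih

theorem conv_assoc {f h k : G → ℤ} (hf : f ∈ compactOpenFun G) (hh : h ∈ compactOpenFun G)
    (hk : k ∈ compactOpenFun G) : 𝓖.conv (𝓖.conv f h) k = 𝓖.conv f (𝓖.conv h k) := by
  refine 𝓖.compactOpenFun_induction (p := fun f => 𝓖.conv (𝓖.conv f h) k = 𝓖.conv f (𝓖.conv h k))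
    (fun U hU => ?_) ?_ (fun f f' hf hf' ih ih' => ?_) (fun f _ ih => ?_) hf
  · have hU' := 𝓖.indicator_mem hU
    refine 𝓖.compactOpenFun_induction (p := fun h => 𝓖.conv (𝓖.conv (U.indicator 1) h) k =
        𝓖.conv (U.indicator 1) (𝓖.conv h k))
      (fun V hV => ?_) ?_ (fun h h' hh hh' ih ih' => ?_) (fun h _ ih => ?_) hh
    · have hV' := 𝓖.indicator_mem hV
      have hUV := 𝓖.conv_mem hU' hV'
      refine 𝓖.compactOpenFun_induction (p := fun k =>
          𝓖.conv (𝓖.conv (U.indicator 1) (V.indicator 1)) k =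
          𝓖.conv (U.indicator 1) (𝓖.conv (V.indicator 1) k))
        (fun W hW => ?_) ?_ (fun k k' _ _ ih ih' => ?_) (fun k _ ih => ?_) hk
      · rw [𝓖.conv_indicator hU.rng_inj, 𝓖.conv_indicator hV.rng_inj,
          𝓖.conv_indicator hU.rng_inj, 𝓖.conv_indicator (hU.mulSet hV).rng_inj, 𝓖.mulSet_assoc]
      · simp only [conv_zero_right]
      · rw [𝓖.conv_add_right hUV, 𝓖.conv_add_right hV', 𝓖.conv_add_right hU', ih, ih']
      · simp only [conv_neg_right, ih]
    · simp only [conv_zero_right, conv_zero_left]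
    · rw [𝓖.conv_add_right hU', 𝓖.conv_add_left (𝓖.conv_mem hU' hh) (𝓖.conv_mem hU' hh'),
        𝓖.conv_add_left hh hh', 𝓖.conv_add_right hU', ih, ih']
    · simp only [conv_neg_right, conv_neg_left, ih]
  · simp only [conv_zero_left]
  · rw [𝓖.conv_add_left hf hf', 𝓖.conv_add_left (𝓖.conv_mem hf hh) (𝓖.conv_mem hf' hh),
      𝓖.conv_add_left hf hf', ih, ih']
  · simp only [conv_neg_left, ih]

variable {𝓖} in
theorem IsCompactBisection.src_image {K : Set X} {B : Set G} (hK : IsCompactOpen K)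
    (hB : 𝓖.IsCompactBisection B) : IsCompactOpen (𝓖.src '' (B ∩ 𝓖.rng ⁻¹' K)) := by
  have : T2Space X := IsAmple.t2 𝓖
  have hsrc : IsOpenMap 𝓖.src := (IsAmple.src_localHomeo (𝓖 := 𝓖)).isOpenMap
  exact ⟨(hB.isCompact.inter_right
      (hK.isCompact.isClosed.preimage 𝓖.continuous_rng)).image 𝓖.continuous_src,
    inferInstance, hsrc _ (hB.isOpen.inter (hK.isOpen.preimage 𝓖.continuous_rng))⟩

theorem act_mem {h : X → ℤ} {f : G → ℤ} (hh : h ∈ compactOpenFun X) (hf : f ∈ compactOpenFun G) :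
    𝓖.act h f ∈ compactOpenFun X := by
  induction hh using AddSubgroup.closure_induction with
  | mem h hh =>
    obtain ⟨K, hK, rfl⟩ := hh
    refine 𝓖.compactOpenFun_induction (p := fun f => 𝓖.act (K.indicator 1) f ∈ compactOpenFun X)
      (fun B hB => ?_) ?_ (fun f f' hf hf' ih ih' => ?_) (fun f _ ih => ?_) hf
    · rw [𝓖.act_indicator K hB.src_inj]
      exact AddSubgroup.subset_closure ⟨_, hB.src_image hK, rfl⟩
    · rw [𝓖.act_zero_right]; exact zero_mem _
    · rw [𝓖.act_add_right _ hf hf']; exact add_mem ih ih'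
    · rw [𝓖.act_neg_right]; exact neg_mem ih
  | zero => rw [𝓖.act_zero_left]; exact zero_mem _
  | add h h' _ _ ih ih' => rw [𝓖.act_add_left _ _ hf]; exact add_mem ih ih'
  | neg h _ ih => rw [𝓖.act_neg_left]; exact neg_mem ih

theorem act_conv {h : X → ℤ} {f k : G → ℤ} (hh : h ∈ compactOpenFun X)
    (hf : f ∈ compactOpenFun G) (hk : k ∈ compactOpenFun G) :
    𝓖.act (𝓖.act h f) k = 𝓖.act h (𝓖.conv f k) := by
  induction hh using AddSubgroup.closure_induction with
  | mem h hh =>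
    obtain ⟨K, hK, rfl⟩ := hh
    refine 𝓖.compactOpenFun_induction (p := fun f => 𝓖.act (𝓖.act (K.indicator 1) f) k =
        𝓖.act (K.indicator 1) (𝓖.conv f k))
      (fun B hB => ?_) ?_ (fun f f' hf hf' ih ih' => ?_) (fun f _ ih => ?_) hf
    · have hB' := 𝓖.indicator_mem hB
      refine 𝓖.compactOpenFun_induction (p := fun k =>
          𝓖.act (𝓖.act (K.indicator 1) (B.indicator 1)) k =
          𝓖.act (K.indicator 1) (𝓖.conv (B.indicator 1) k))
        (fun C hC => ?_) ?_ (fun k k' hk hk' ih ih' => ?_) (fun k _ ih => ?_) hk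
      · rw [𝓖.act_indicator K hB.src_inj, 𝓖.act_indicator _ hC.src_inj,
          𝓖.conv_indicator hB.rng_inj, 𝓖.act_indicator _ (hB.mulSet hC).src_inj,
          𝓖.src_image_mulSet]
      · simp only [conv_zero_right, act_zero_right]
      · rw [𝓖.act_add_right _ hk hk', 𝓖.conv_add_right hB',
          𝓖.act_add_right _ (𝓖.conv_mem hB' hk) (𝓖.conv_mem hB' hk'), ih, ih']
      · simp only [conv_neg_right, act_neg_right, ih]
    · simp only [conv_zero_left, act_zero_right, act_zero_left]
    · rw [𝓖.act_add_right _ hf hf', 𝓖.act_add_left _ _ hk, 𝓖.conv_add_left hf hf',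
        𝓖.act_add_right _ (𝓖.conv_mem hf hk) (𝓖.conv_mem hf' hk), ih, ih']
    · simp only [conv_neg_left, act_neg_left, act_neg_right, ih]
  | zero => simp only [act_zero_left]
  | add h h' _ _ ih ih' =>
    rw [𝓖.act_add_left _ _ hf, 𝓖.act_add_left _ _ hk, 𝓖.act_add_left _ _ (𝓖.conv_mem hf hk),
      ih, ih']
  | neg h _ ih => simp only [act_neg_left, ih]

theorem exists_unit_support {f : G → ℤ} (hf : f ∈ compactOpenFun G) :
    ∃ K : Set X, IsCompact K ∧ IsOpen K ∧ ∀ g, f g ≠ 0 → 𝓖.rng g ∈ K := by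
  refine 𝓖.compactOpenFun_induction
    (p := fun f => ∃ K : Set X, IsCompact K ∧ IsOpen K ∧ ∀ g, f g ≠ 0 → 𝓖.rng g ∈ K)
    (fun B hB => ?_) ?_ (fun f f' hf hf' ih ih' => ?_) (fun f _ ih => ?_) hf
  · exact ⟨_, hB.isCompact.image 𝓖.continuous_rng, 𝓖.rng_localHomeo.isOpenMap _ hB.isOpen,
      fun g hg => Set.mem_image_of_mem _ (Set.mem_of_indicator_ne_zero hg)⟩
  · exact ⟨∅, isCompact_empty, isOpen_empty, fun g hg => (hg rfl).elim⟩
  · obtain ⟨K, hK, hKo, h⟩ := ih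
    obtain ⟨K', hK', hKo', h'⟩ := ih'
    refine ⟨K ∪ K', hK.union hK', hKo.union hKo', fun g hg => ?_⟩
    by_contra hn
    rw [Set.mem_union, not_or] at hn
    have h1 : f g = 0 := not_not.1 fun hne => hn.1 (h g hne)
    have h2 : f' g = 0 := not_not.1 fun hne => hn.2 (h' g hne)
    exact hg (by rw [Pi.add_apply, h1, h2, add_zero])
  · obtain ⟨K, hK, hKo, h⟩ := ih
    exact ⟨K, hK, hKo, fun g hg => h g (neg_ne_zero.1 hg)⟩

theorem isCompactBisection_one {K : Set X} (hK : IsCompact K) (hKo : IsOpen K) :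
    𝓖.IsCompactBisection (𝓖.one '' K) := by
  refine ⟨hK.image 𝓖.continuous_one, 𝓖.one_localHomeo.isOpenMap _ hKo, ?_, ?_⟩
  · rintro _ ⟨x, -, rfl⟩ _ ⟨y, -, rfl⟩ h
    rw [𝓖.src_one, 𝓖.src_one] at h
    rw [h]
  · rintro _ ⟨x, -, rfl⟩ _ ⟨y, -, rfl⟩ h
    rw [𝓖.rng_one, 𝓖.rng_one] at h
    rw [h]

end Ample

/-- The ring `ℤ𝓖` of an ample groupoid: the group of functions on the space of arrows generated by
the characteristic functions of compact open sets, with the convolution product. -/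
def Alg (_ : TopGroupoid X G) : Type u := compactOpenFun G

/-- The trivial right `ℤ𝓖`-module `ℤ𝓖⁰`: the group of functions on the unit space generated by the
characteristic functions of compact open sets, with `ℤ𝓖` acting by `act`. -/
def Triv (_ : TopGroupoid X G) : Type u := compactOpenFun X

instance : AddCommGroup 𝓖.Alg := inferInstanceAs (AddCommGroup (compactOpenFun G))

instance : AddCommGroup 𝓖.Triv := inferInstanceAs (AddCommGroup (compactOpenFun X))

section Ample

variable [𝓖.IsAmple]

noncomputable instance : NonUnitalRing 𝓖.Alg where
  mul f h := ⟨𝓖.conv f.1 h.1, 𝓖.conv_mem f.2 h.2⟩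
  left_distrib f h h' := Subtype.ext (𝓖.conv_add_right f.2 h.1 h'.1)
  right_distrib f f' h := Subtype.ext (𝓖.conv_add_left f.2 f'.2 h.1)
  zero_mul h := Subtype.ext (𝓖.conv_zero_left h.1)
  mul_zero f := Subtype.ext (𝓖.conv_zero_right f.1)
  mul_assoc f h k := Subtype.ext (𝓖.conv_assoc f.2 h.2 k.2)

instance : HasLeftLocalUnits 𝓖.Alg where
  exists_unit f h := by
    obtain ⟨K, hK, hKo, hf⟩ := 𝓖.exists_unit_support f.2
    obtain ⟨K', hK', hKo', hh⟩ := 𝓖.exists_unit_support h.2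
    refine ⟨⟨(𝓖.one '' (K ∪ K')).indicator 1,
      𝓖.indicator_mem (𝓖.isCompactBisection_one (hK.union hK') (hKo.union hKo'))⟩,
      Subtype.ext (𝓖.conv_one fun g hg => ?_),
      Subtype.ext (𝓖.conv_one fun g hg => Or.inl (hf g hg)),
      Subtype.ext (𝓖.conv_one fun g hg => Or.inr (hh g hg))⟩
    obtain ⟨x, hx, rfl⟩ := Set.mem_of_indicator_ne_zero hg
    rwa [𝓖.rng_one]

/-- The right action of `ℤ𝓖` on `ℤ𝓖⁰`. -/
noncomputable def trivAct : 𝓖.Triv →+ 𝓖.Alg →+ 𝓖.Triv :=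
  AddMonoidHom.mk' (fun h => AddMonoidHom.mk' (fun f => ⟨𝓖.act h.1 f.1, 𝓖.act_mem h.2 f.2⟩)
    fun f f' => Subtype.ext (𝓖.act_add_right h.1 f.2 f'.2))
    fun h h' => AddMonoidHom.ext fun f => Subtype.ext (𝓖.act_add_left h.1 h'.1 f.2)

theorem trivAct_mul (h : 𝓖.Triv) (f k : 𝓖.Alg) :
    𝓖.trivAct h (f * k) = 𝓖.trivAct (𝓖.trivAct h f) k :=
  Subtype.ext (𝓖.act_conv h.2 f.2 k.2).symm

noncomputable instance : Module (AdjoinUnit 𝓖.Alg)ᵐᵒᵖ 𝓖.Triv :=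
  rightModule 𝓖.trivAct 𝓖.trivAct_mul

/-- The homology `H_n(𝓖, M) = Tor_n^{ℤ𝓖}(ℤ𝓖⁰, M)` of an ample groupoid with coefficients in a
unitary left `ℤ𝓖`-module `M`. -/
noncomputable def homology (n : ℕ) (M : UnitaryMod 𝓖.Alg) : AddCommGrpCat.{u} :=
  Tor 𝓖.Alg 𝓖.Triv n M

/-- The homological dimension `sup {n | H_n(𝓖, -) ≠ 0}`. -/
noncomputable def homologicalDimension : ℕ∞ :=
  sSup {d : ℕ∞ | ∃ n : ℕ, d = n ∧ ∃ M : UnitaryMod 𝓖.Alg, ¬ Limits.IsZero (𝓖.homology n M)}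

end Ample

end TopGroupoid

end Groupoids

end AmpleHomology

/-! Both directions pass through elements `b` of ℤ𝓖 that are invariant under right multiplication by
a given compact set of arrows and have sum 1 over the arrows starting at each of the relevant units
(`𝓖.act 1 b x = 1`).

Suppose 𝓖 is AF. A compact open principal subgroupoid `H` has a compact open fundamental domain `D`,
and the characteristic function of `H ∩ r⁻¹(D)` is such a `b` for `H`
(`exists_invariant_of_isPrincipalOn`). This makes ℤ𝓖⁰ flat. Any tensor is `1_K ⊗ m`; if it dies
under `M → M'`, only finitely many balancing relations are involved, and multiplication by a
sufficiently invariant `b` annihilates them, so `b 1_K m` dies in `M'`. The fibre sums of `b` are 1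
on `K`, hence `1_K ⊗ m = 1_L ⊗ b 1_K m` for any compact open `L` containing the ranges of the
support of `b` (`IsAF.isZero_homology_succ`).

Conversely, only the vanishing of `H_1` is needed. It gives the equational criterion
`mem_closure_of_isZero_Tor_one`. For a compact open symmetric set `W` containing its units, covered
by bisections `B_i`, the elements `1_{B_i} - 1_{s(B_i)}` kill `1_K` with `K = s(W)`; the criterion
therefore writes `1_K` through elements annihilating them from the left, which are exactly the
functions invariant under the `B_i`. These combine into one `b`
(`exists_invariant_of_isZero_homology_one`). It is invariant under the subgroupoid generated by `W`
too. The isotropy group at `x` acts freely on the support of `b` over `x`, so its order divides the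
fibre sum 1 and it is trivial (`IsRightInvariant.eq_one_of_src_eq_rng`). The supports of `b` in the
range fibres are uniformly bounded, which bounds the stars of the generated subgroupoid and makes it
a finite power of `W`, hence compact and open (`exists_subgroupoid_of_isRightInvariant`). -/

namespace CategoryTheory

/-! ### Derived functors and projective resolutions with a prescribed last differential. -/

open Limits

universe v₁ v₂ u₁ u₂

variable {C : Type u₁} [Category.{v₁} C] [Abelian C] [EnoughProjectives C]
  {D : Type u₂} [Category.{v₂} D] [Abelian D]

/-- An additive functor which preserves exactness has trivial higher left derived functors. -/
theorem isZero_leftDerived_succ_of_map_exact (F : C ⥤ D) [F.Additive]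
    (hF : ∀ S : ShortComplex C, S.Exact → (S.map F).Exact) (n : ℕ) (X : C) :
    IsZero ((F.leftDerived (n + 1)).obj X) := by
  let P := ProjectiveResolution.of X
  refine IsZero.of_iso ?_ (P.isoLeftDerivedObj F (n + 1))
  refine (HomologicalComplex.exactAt_iff_isZero_homology _ _).1 ?_
  exact hF _ (P.complex_exactAt_succ n)

theorem Projective.d_comp_self {X Y : C} (f : X ⟶ Y) : Projective.d f ≫ f = 0 :=
  (Category.assoc _ _ _).trans ((congrArg _ (kernel.condition f)).trans comp_zero)

/-- The projective cover of the kernel of a morphism, as the next step of a complex. -/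
noncomputable def syzygyStep {X Y : C} (f : X ⟶ Y) : Σ' (Z : C) (d : Z ⟶ X), d ≫ f = 0 :=
  ⟨_, Projective.d f, Projective.d_comp_self f⟩

/-- The complex of projective objects which starts with a given morphism `P ⟶ Q`, continued to the
left by projective covers of kernels. -/
noncomputable def resolutionComplex {P Q : C} (φ : P ⟶ Q) : ChainComplex C ℕ :=
  ChainComplex.mk' Q P φ syzygyStep

/-- The first derived functor sees only degrees 2, 1 and 0, so this differential and the next one
are the only ones that have to be identified. -/
theorem resolutionComplex_d_one_zero {P Q : C} (φ : P ⟶ Q) : (resolutionComplex φ).d 1 0 = φ :=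
  ChainComplex.mk'_d_1_0 _ _ _ _

theorem resolutionComplex_d_two_one {P Q : C} (φ : P ⟶ Q) :
    (resolutionComplex φ).d 2 1 = Projective.d φ :=
  ChainComplex.mk_d_2_1 _ _ _ _ _ _ _

/-- Each new differential is a projective cover of the kernel of the preceding one, and `exact_d_f`
is exactness at such a step. -/
theorem resolutionComplex_exactAt_succ {P Q : C} (φ : P ⟶ Q) (n : ℕ) :
    (resolutionComplex φ).ExactAt (n + 1) := by
  rw [HomologicalComplex.exactAt_iff' _ (n + 1 + 1) (n + 1) n (by simp) (by simp)]
  refine ShortComplex.exact_of_iso ?_ (exact_d_f ((resolutionComplex φ).d (n + 1) n))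
  refine ShortComplex.isoMk (ChainComplex.mk'XIso Q P φ syzygyStep n).symm (Iso.refl _)
    (Iso.refl _) ?_ ((Category.id_comp _).trans (Category.comp_id _).symm)
  refine Eq.trans ?_ (Category.comp_id _).symm
  exact (Iso.inv_comp_eq _).2 (ChainComplex.mk'_d Q P φ syzygyStep n)

theorem resolutionComplex_projective {P Q : C} (φ : P ⟶ Q) [Projective P] [Projective Q] (n : ℕ) :
    Projective ((resolutionComplex φ).X n) := by
  obtain (_ | _ | _ | n) := n
  · exact ‹Projective Q›
  · exact ‹Projective P›
  all_goals apply Projective.projective_over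

/-- An exact complex of projective objects with an augmentation which is a cokernel of its last
differential is a projective resolution. -/
noncomputable def ProjectiveResolution.mkOfExact {Z : C} (K : ChainComplex C ℕ)
    (hK : ∀ n, Projective (K.X n)) (hK' : ∀ n, K.ExactAt (n + 1)) (d : K.X 1 ⟶ K.X 0)
    (hd : K.d 1 0 = d) (ε : K.X 0 ⟶ Z) (hε : Epi ε)
    (w : d ≫ ε = 0) (hd' : (ShortComplex.mk _ _ w).Exact) : ProjectiveResolution Z where
  complex := K
  projective := hK
  π := (ChainComplex.toSingle₀Equiv _ _).symm ⟨ε, hd ▸ w⟩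
  quasiIso := ⟨fun n => by
    -- Keeping `d` separate from `K.d 1 0` until here lets the augmentation be stated for a morphism
    -- given explicitly.
    subst hd
    cases n
    -- In degree 0 the condition is exactness of `K₁ ⟶ K₀ ⟶ Z ⟶ 0`; in positive degrees the target
    -- complex is exact, so it is exactness of `K`.
    · rw [ChainComplex.quasiIsoAt₀_iff, ShortComplex.quasiIso_iff_of_zeros']
      · refine (ShortComplex.exact_and_epi_g_iff_of_iso ?_).2 ⟨hd', hε⟩
        exact ShortComplex.isoMk (Iso.refl _) (Iso.refl _) (Iso.refl _)
          ((Category.id_comp _).trans (Category.comp_id _).symm)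
          (by
            refine (Category.id_comp _).trans (Eq.trans ?_ (Category.comp_id _).symm)
            simp
            rfl)
      · exact K.shape _ _ (by simp)
      all_goals rfl
    · rw [quasiIsoAt_iff_exactAt']
      · apply hK'
      · apply ChainComplex.exactAt_succ_single_obj⟩

/-- A projective resolution of the cokernel of a morphism of projective objects which starts with
this morphism. -/
noncomputable def cokernelResolution {P Q : C} (φ : P ⟶ Q) [Projective P] [Projective Q] :
    ProjectiveResolution (cokernel φ) :=
  .mkOfExact (resolutionComplex φ) (resolutionComplex_projective φ)
    (resolutionComplex_exactAt_succ φ) φ (resolutionComplex_d_one_zero φ) (cokernel.π φ)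
    (inferInstanceAs (Epi (cokernel.π φ))) (cokernel.condition φ) (ShortComplex.exact_cokernel φ)

/-- If the first left derived functor of `F` vanishes, then `F` sends a resolution of the kernel of
a morphism of projective objects to an exact sequence. -/
theorem exact_map_d_of_isZero_leftDerived_one (F : C ⥤ D) [F.Additive] {P Q : C} (φ : P ⟶ Q)
    [Projective P] [Projective Q] (h : IsZero ((F.leftDerived 1).obj (cokernel φ))) :
    ((ShortComplex.mk (Projective.d φ) φ (Projective.d_comp_self φ)).map F).Exact := by
  have h1 := h.of_iso ((cokernelResolution φ).isoLeftDerivedObj F 1).symm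
  have h2 := (HomologicalComplex.exactAt_iff_isZero_homology _ _).2 h1
  rw [HomologicalComplex.exactAt_iff' _ 2 1 0 (by simp) (by simp)] at h2
  refine ShortComplex.exact_of_iso ?_ h2
  refine ShortComplex.isoMk (Iso.refl (F.obj (Projective.syzygies φ))) (Iso.refl (F.obj P))
    (Iso.refl (F.obj Q)) ?_ ?_
  · refine (Category.id_comp _).trans (Eq.trans ?_ (Category.comp_id _).symm)
    exact congrArg F.map (resolutionComplex_d_two_one φ).symm
  · refine (Category.id_comp _).trans (Eq.trans ?_ (Category.comp_id _).symm)
    exact congrArg F.map (resolutionComplex_d_one_zero φ).symm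

/-- Finitely many morphisms to a projective object are the components of a morphism to a projective
object. -/
theorem exists_lift_sum {C : Type u₁} [Category.{v₁} C] [Abelian C]
    {ι : Type v₁} [Fintype ι] {P Q : C} [Projective Q] (f : ι → (P ⟶ Q)) :
    ∃ (R : C) (φ : P ⟶ R) (p : ι → (R ⟶ Q)) (j : ι → (Q ⟶ R)), Projective R ∧
      φ = ∑ i, f i ≫ j i ∧ ∀ i, φ ≫ p i = f i := by
  classical
  have := Abelian.hasFiniteBiproducts (C := C)
  -- `R` is the biproduct of copies of `Q`. The sum formula will show that the image of `φ` under a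
  -- functor kills an element; the projections recover the `f i` from `φ`.
  refine ⟨⨁ fun _ : ι => Q, biproduct.lift f, biproduct.π _, biproduct.ι _, inferInstance,
    biproduct.hom_ext _ _ fun k => ?_, biproduct.lift_π f⟩
  rw [Preadditive.sum_comp, Finset.sum_eq_single k, Category.assoc, biproduct.ι_π_self,
    Category.comp_id, biproduct.lift_π]
  · intro i _ hi
    rw [Category.assoc, biproduct.ι_π_ne _ hi, comp_zero]
  · exact fun hk => (hk (Finset.mem_univ k)).elim

end CategoryTheory

namespace AmpleHomology

/-! ### Calculus of balanced tensors. -/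

section TensorExactness

open TensorProduct MulOpposite

variable {S : Type u} [Ring S] {N : Type u} [AddCommGroup N] [Module Sᵐᵒᵖ N]
  {M M' : Type u} [AddCommGroup M] [Module S M] [AddCommGroup M'] [Module S M']

/-- The pure tensor `n ⊗ m` in the balanced tensor product. -/
def BalancedTensor.tmul (n : N) (m : M) : BalancedTensor S N M :=
  QuotientAddGroup.mk (n ⊗ₜ[ℤ] m)

theorem BalancedTensor.tmul_add (n : N) (m m' : M) :
    tmul (S := S) n (m + m') = tmul n m + tmul n m' :=
  congrArg QuotientAddGroup.mk (TensorProduct.tmul_add n m m')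

theorem BalancedTensor.tmul_zero (n : N) : tmul (S := S) n (0 : M) = 0 :=
  congrArg QuotientAddGroup.mk (TensorProduct.tmul_zero M n)

theorem BalancedTensor.zero_tmul (m : M) : tmul (S := S) (0 : N) m = 0 :=
  congrArg QuotientAddGroup.mk (TensorProduct.zero_tmul N m)

theorem BalancedTensor.smul_tmul (n : N) (s : S) (m : M) :
    tmul (S := S) (op s • n) m = tmul n (s • m) :=
  QuotientAddGroup.eq_iff_sub_mem.2 (AddSubgroup.subset_closure ⟨n, s, m, rfl⟩)

theorem BalancedTensor.map_tmul (f : M →ₗ[S] M') (n : N) (m : M) :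
    BalancedTensor.map S N f (tmul n m) = tmul n (f m) :=
  rfl

theorem BalancedTensor.induction_on {p : BalancedTensor S N M → Prop} (t : BalancedTensor S N M)
    (zero : p 0) (tmul : ∀ n m, p (tmul n m)) (add : ∀ t t', p t → p t' → p (t + t')) : p t := by
  obtain ⟨t, rfl⟩ := QuotientAddGroup.mk_surjective t
  induction t using TensorProduct.induction_on with
  | zero => exact zero
  | tmul n m => exact tmul n m
  | add x y hx hy => exact add _ _ hx hy

variable (S N) in
/-- The map `N ⊗_S S → N`, `n ⊗ s ↦ n s`, restricted to a left ideal. -/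
def BalancedTensor.mulIdeal (I : Submodule S S) : BalancedTensor S N I →+ N :=
  QuotientAddGroup.lift _ (TensorProduct.liftAddHom
      (AddMonoidHom.mk' (fun n => AddMonoidHom.mk' (fun x : I => op (x : S) • n)
        fun x y => by rw [Submodule.coe_add, MulOpposite.op_add, add_smul])
        fun n n' => AddMonoidHom.ext fun x => smul_add _ _ _)
      fun k n x => by
        change op (x : S) • (k • n) = op ((k • x : I) : S) • n
        rw [Submodule.coe_smul_of_tower, MulOpposite.op_smul, smul_assoc, smul_comm]) (by
    rw [balancedRel, AddSubgroup.closure_le]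
    rintro _ ⟨n, s, m, rfl⟩
    refine (map_sub _ _ _).trans (sub_eq_zero.2 ?_)
    change op (m : S) • op s • n = op (s • m : S) • n
    rw [smul_smul, ← MulOpposite.op_mul, smul_eq_mul])

end TensorExactness

/-! ### The projective unitary modules `A e` and the equational criterion for flatness. -/

section Unitary

variable {A : Type u} [NonUnitalRing A]

theorem incl_injective : Function.Injective (incl : A → AdjoinUnit A) :=
  Unitization.inr_injective

theorem exists_incl_eq_of_mem_span {e : A} {x : AdjoinUnit A}
    (hx : x ∈ Submodule.span (AdjoinUnit A) {incl e}) : ∃ b : A, incl b = x := by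
  obtain ⟨y, rfl⟩ := Submodule.mem_span_singleton.1 hx
  exact exists_incl_eq_mul y e

variable [HasLeftLocalUnits A]

instance : (isUnitary A).ι.PreservesEpimorphisms :=
  ObjectProperty.preservesEpimorphisms_ι_of_isNormalMonoCategory (isUnitary A)

/-- The inclusion of the unitary modules preserves kernels and epimorphisms, hence homology.
Exactness can thus be tested on elements. -/
theorem map_ι_exact {S : ShortComplex (UnitaryMod A)} (hS : S.Exact) :
    (S.map (isUnitary A).ι).Exact := by
  have := (isUnitary A).preservesKernels_ι
  have := Functor.preservesHomology_of_preservesEpis_and_kernels (isUnitary A).ι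
  exact hS.map _

theorem projective_of_projective_obj (P : UnitaryMod A) [Projective P.obj] : Projective P :=
  Projective.mk fun {_ _} f e _ =>
    have : Epi e.hom := inferInstanceAs (Epi ((isUnitary A).ι.map e))
    ⟨ObjectProperty.homMk (Projective.factorThru f.hom e.hom),
        ObjectProperty.hom_ext _ (Projective.factorThru_comp _ _)⟩

/-- The unitary module `A e`. -/
noncomputable def idealMod (e : A) : UnitaryMod A :=
  ⟨ModuleCat.of _ (Submodule.span (AdjoinUnit A) {incl e}), (isUnitary_iff _).2 fun x => by
    obtain ⟨b, hb⟩ := exists_incl_eq_of_mem_span x.2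
    obtain ⟨d, hd, hdb, -⟩ := HasLeftLocalUnits.exists_unit b b
    refine ⟨d, hd, Subtype.ext ?_⟩
    change incl d * (x : AdjoinUnit A) = x
    rw [← hb, ← map_mul, hdb]⟩

theorem projective_idealMod {e : A} (he : e * e = e) : Projective (idealMod e) := by
  have := projective_span e he
  have : Projective (idealMod e).obj := (IsProjective.iff_projective _).1 this
  exact projective_of_projective_obj _

/-- Right multiplication by `a ∈ A e` on `A e`. -/
noncomputable def idealModMul (e a : A) (ha : a * e = a) : idealMod e ⟶ idealMod e :=
  ObjectProperty.homMk (ModuleCat.ofHom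
    (((LinearMap.toSpanSingleton (AdjoinUnit A) (AdjoinUnit A) (incl a)).comp
      (Submodule.subtype _)).codRestrict _ fun x =>
        Submodule.mem_span_singleton.2 ⟨(x : AdjoinUnit A) * incl a, by
          change (x : AdjoinUnit A) * incl a * incl e = (x : AdjoinUnit A) * incl a
          rw [mul_assoc, ← map_mul, ha]⟩))

/-- The inclusion of `A e` in `ℤ ⊕ A`. -/
noncomputable def idealModVal (e : A) : (idealMod e).obj →ₗ[AdjoinUnit A] AdjoinUnit A :=
  Submodule.subtype (Submodule.span (AdjoinUnit A) {incl e})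

theorem idealModVal_mul (e a : A) (ha : a * e = a) (x : (idealMod e).obj) :
    idealModVal e ((idealModMul e a ha).hom.hom x) = idealModVal e x * incl a :=
  rfl

open MulOpposite BalancedTensor

variable (N : Type u) [AddCommGroup N] [Module (AdjoinUnit A)ᵐᵒᵖ N]

/-- If every tensor which is killed by a map of modules is a pure tensor `n ⊗ m` such that `m` is
killed by that map, then the higher `Tor` groups vanish. -/
theorem isZero_Tor_succ_of_exists_tmul
    (h : ∀ (M M' : ModuleCat.{u} (AdjoinUnit A)) (g : M →ₗ[AdjoinUnit A] M'),
      ∀ t : BalancedTensor (AdjoinUnit A) N M,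
        BalancedTensor.map (AdjoinUnit A) N g t = 0 → ∃ (n : N) (m : M), g m = 0 ∧ t = tmul n m)
    (n : ℕ) (M : UnitaryMod A) : Limits.IsZero (Tor A N (n + 1) M) := by
  refine isZero_leftDerived_succ_of_map_exact _ (fun S hS => ?_) n M
  have hS' := (ShortComplex.moduleCat_exact_iff _).1 (map_ι_exact hS)
  refine (ShortComplex.ab_exact_iff _).2 fun t ht => ?_
  -- Since `m` itself is killed, it lifts along `S.f`, and the tensor lifts with it.
  obtain ⟨n, m, hm, rfl⟩ := h S.X₂.obj S.X₃.obj S.g.hom.hom t ht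
  obtain ⟨x, rfl⟩ := hS' m hm
  exact ⟨tmul n x, rfl⟩

/-- The map `N ⊗ A e → N`, `n ⊗ x ↦ n x`. -/
noncomputable def idealModEval (e : A) :
    BalancedTensor (AdjoinUnit A) N (idealMod e).obj →+ N :=
  mulIdeal (AdjoinUnit A) N (Submodule.span (AdjoinUnit A) {incl e})

/-- The generator of `A e`. -/
noncomputable def idealModGen (e : A) : (idealMod e).obj :=
  (⟨incl e, Submodule.mem_span_singleton_self _⟩ : Submodule.span (AdjoinUnit A) {incl e})

theorem idealModVal_gen (e : A) : idealModVal e (idealModGen e) = incl e := rfl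

theorem idealModVal_injective (e : A) : Function.Injective (idealModVal e) :=
  Subtype.val_injective

/-- Because `a * e = a`, the generator goes to a multiple of itself, and the multiplier can then be
moved across the tensor sign to act on `N`. -/
theorem idealModMul_gen {e : A} (a : A) (ha : a * e = a) :
    (idealModMul e a ha).hom.hom (idealModGen e) = incl (e * a) • idealModGen e := by
  refine idealModVal_injective e ?_
  rw [idealModVal_mul, map_smul, idealModVal_gen, smul_eq_mul, ← map_mul, ← map_mul, mul_assoc, ha]

/-- The equational criterion: if `Tor_1(N, -)` vanishes, then an element of `N` which is killed by
finitely many ring elements is a sum of multiples of ring elements which are killed by them. -/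
theorem mem_closure_of_isZero_Tor_one (h : ∀ M : UnitaryMod A, Limits.IsZero (Tor A N 1 M))
    {ι : Type u} [Fintype ι] {e : A} (he : e * e = e) (a : ι → A) (ha : ∀ i, a i * e = a i) (n : N)
    (hn : ∀ i, op (incl (e * a i)) • n = 0) :
    op (incl e) • n ∈
      AddSubgroup.closure {x | ∃ (n' : N) (b : A), (∀ i, b * a i = 0) ∧ x = op (incl b) • n'} := by
  have := projective_idealMod he
  let F := (isUnitary A).ι ⋙ tensorFunctor (AdjoinUnit A) N
  -- `φ` combines all right multiplications by the `a i` into one map out of `A e`; the vanishing of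
  -- `Tor_1` is used for its cokernel.
  obtain ⟨Q, φ, p, j, hQ, hφ, hp⟩ := exists_lift_sum fun i => idealModMul e (a i) (ha i)
  have hex := (ShortComplex.ab_exact_iff _).1 (exact_map_d_of_isZero_leftDerived_one F φ (h _))
  -- The tensor `n ⊗ e` is killed by `φ`, since `n (e a i) = 0`; exactness will lift it to the
  -- projective cover of the kernel of `φ`.
  have ht : ∃ t : F.obj (idealMod e), t = tmul (S := AdjoinUnit A) n (idealModGen e) := ⟨_, rfl⟩
  obtain ⟨t, ht⟩ := ht
  have hφt : (F.map φ).hom t = 0 := by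
    rw [hφ]
    refine Finset.sum_induction _ (fun f : idealMod e ⟶ Q => (F.map f).hom t = 0)
      (fun f g hf hg => ?_) ?_ fun i _ => ?_
    · rw [F.map_add, AddCommGrpCat.hom_add, AddMonoidHom.add_apply, hf, hg, add_zero]
    · rw [F.map_zero]
      rfl
    · have h1 : (F.map (idealModMul e (a i) (ha i))).hom t = 0 := by
        rw [ht]
        change tmul (S := AdjoinUnit A) n
          ((idealModMul e (a i) (ha i)).hom.hom (idealModGen e)) = 0
        rw [idealModMul_gen, ← smul_tmul, hn, zero_tmul]
      rw [F.map_comp, AddCommGrpCat.hom_comp, AddMonoidHom.comp_apply, h1, map_zero]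
  obtain ⟨r, hr⟩ := hex t hφt
  -- An element of `A e` in the kernel of `φ` is some `b` with `b * a i = 0` for all `i`, so
  -- evaluating `n' ⊗ b` gives a generator of the closure.
  have key : ∀ r : BalancedTensor (AdjoinUnit A) N (Projective.syzygies φ).obj,
      (idealModEval N e).comp (BalancedTensor.map (AdjoinUnit A) N
        (Projective.d φ).hom.hom) r ∈ AddSubgroup.closure
          {x | ∃ (n' : N) (b : A), (∀ i, b * a i = 0) ∧ x = op (incl b) • n'} := by
    intro r
    induction r using BalancedTensor.induction_on with
    | zero => rw [map_zero]; exact zero_mem _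
    | add r r' hr hr' => rw [map_add]; exact add_mem hr hr'
    | tmul n' r =>
      obtain ⟨b, hb⟩ : ∃ b : A, incl b = idealModVal e ((Projective.d φ).hom.hom r) :=
        exists_incl_eq_of_mem_span (Subtype.property (p := (· ∈ Submodule.span (AdjoinUnit A)
          {incl e})) ((Projective.d φ).hom.hom r))
      refine AddSubgroup.subset_closure ⟨n', b, fun i => incl_injective ?_, ?_⟩
      · have h1 : Projective.d φ ≫ idealModMul e (a i) (ha i) = 0 := by
          rw [← hp, ← Category.assoc, Projective.d_comp_self, Limits.zero_comp]
        rw [map_mul, hb, ← idealModVal_mul e (a i) (ha i), map_zero, ← map_zero (idealModVal e)]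
        exact congrArg (fun f => idealModVal e (f.hom.hom r)) h1
      · rw [hb]
        rfl
  have := key r
  have h2 : (BalancedTensor.map (AdjoinUnit A) N (Projective.d φ).hom.hom) r =
    tmul (S := AdjoinUnit A) n (idealModGen e) := hr.trans ht
  -- Evaluation of the lifted tensor returns `n e`.
  have h3 : (idealModEval N e).comp (BalancedTensor.map (AdjoinUnit A) N
      (Projective.d φ).hom.hom) r = op (incl e) • n := congrArg (idealModEval N e) h2
  exact h3 ▸ this

end Unitary

end AmpleHomology

namespace AmpleHomology

namespace TopGroupoid

variable {X G : Type u} [TopologicalSpace X] [TopologicalSpace G] (𝓖 : TopGroupoid X G)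

/-! ### Convolution with bisections and right-invariant functions. -/

section Algebra

theorem inv_one (x : X) : 𝓖.inv (𝓖.one x) = 𝓖.one x := by
  have h2 := 𝓖.mul_one (𝓖.inv (𝓖.one x))
  have h3 := 𝓖.inv_mul (𝓖.one x)
  simp only [𝓖.src_inv, 𝓖.rng_one, 𝓖.src_one] at h2 h3
  exact h2.symm.trans h3

theorem mul_one_of_eq (g : G) {x : X} (h : 𝓖.src g = 𝓖.rng (𝓖.one x)) :
    𝓖.mul g (𝓖.one x) h = g := by
  obtain rfl : 𝓖.src g = x := h.trans (𝓖.rng_one x)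
  exact 𝓖.mul_one g

theorem one_mul_of_eq (g : G) {x : X} (h : 𝓖.src (𝓖.one x) = 𝓖.rng g) :
    𝓖.mul (𝓖.one x) g h = g := by
  obtain rfl : 𝓖.rng g = x := h.symm.trans (𝓖.src_one x)
  exact 𝓖.one_mul g

theorem mul_mul_inv (g u : G) (h) (h') : 𝓖.mul (𝓖.mul g u h) (𝓖.inv u) h' = g := by
  rw [𝓖.mul_assoc g u (𝓖.inv u) h (𝓖.rng_inv u).symm]
  simp only [𝓖.mul_inv]
  exact 𝓖.mul_one_of_eq g _

theorem mul_inv_mul (g u : G) (h) (h') : 𝓖.mul (𝓖.mul g (𝓖.inv u) h) u h' = g := by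
  rw [𝓖.mul_assoc g (𝓖.inv u) u h (𝓖.src_inv u)]
  simp only [𝓖.inv_mul]
  exact 𝓖.mul_one_of_eq g _

theorem mul_left_cancel {g u v : G} {h h'} (e : 𝓖.mul g u h = 𝓖.mul g v h') : u = v := by
  have h1 := 𝓖.inv_mul_cancel_left g u h ((𝓖.src_inv g).trans (𝓖.rng_mul _ _ _).symm)
  have h2 := 𝓖.inv_mul_cancel_left g v h' ((𝓖.src_inv g).trans (𝓖.rng_mul _ _ _).symm)
  rw [← h1, ← h2]
  simp only [e]

variable {𝓖} {H : Set G}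

theorem IsSubgroupoid.one_src_mem (hH : 𝓖.IsSubgroupoid H) {g : G} (hg : g ∈ H) :
    𝓖.one (𝓖.src g) ∈ H := by
  rw [← 𝓖.inv_mul]
  exact hH.mul_mem _ (hH.inv_mem g hg) _ hg _

theorem IsSubgroupoid.mul_mem_iff (hH : 𝓖.IsSubgroupoid H) {g u : G} (hu : u ∈ H) (h) :
    𝓖.mul g u h ∈ H ↔ g ∈ H := by
  refine ⟨fun hg => ?_, fun hg => hH.mul_mem g hg u hu h⟩
  rw [← 𝓖.mul_mul_inv g u h ((𝓖.src_mul _ _ _).trans (𝓖.rng_inv u).symm)]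
  exact hH.mul_mem _ hg _ (hH.inv_mem u hu) _

/-- In a principal subgroupoid an arrow is determined by its source and range. -/
theorem IsPrincipalOn.ext (hH : 𝓖.IsSubgroupoid H) (hP : 𝓖.IsPrincipalOn H) {g h : G}
    (hg : g ∈ H) (hh : h ∈ H) (hs : 𝓖.src g = 𝓖.src h) (hr : 𝓖.rng g = 𝓖.rng h) : g = h := by
  have hi : 𝓖.src g = 𝓖.rng (𝓖.inv h) := hs.trans (𝓖.rng_inv h).symm
  have h1 := hP _ (hH.mul_mem g hg _ (hH.inv_mem h hh) hi)
    (by rw [𝓖.src_mul, 𝓖.rng_mul, 𝓖.src_inv, hr])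
  have h2 := 𝓖.mul_inv_mul g h hi ((𝓖.src_mul _ _ _).trans (𝓖.src_inv h))
  rw [← h2]
  simp only [h1.trans (congrArg 𝓖.one ((𝓖.src_mul _ _ _).trans (𝓖.src_inv h)))]
  exact 𝓖.one_mul_of_eq h _

variable (𝓖)

/-- A function on the arrows is invariant under right multiplication by the arrows in `B`. -/
def IsRightInvariant (f : G → ℤ) (B : Set G) : Prop :=
  ∀ u ∈ B, ∀ g h, f (𝓖.mul g u h) = f g

/-- As the source map is injective on `B`, the only factorization of `g` with second factor in `B`
is `(g u⁻¹) u`. -/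
theorem conv_indicator_right {B : Set G} (hB : Set.InjOn 𝓖.src B) (f : G → ℤ) {u g : G}
    (hu : u ∈ B) (h : 𝓖.src g = 𝓖.src u) :
    𝓖.conv f (B.indicator 1) g = f (𝓖.mul g (𝓖.inv u) (h.trans (𝓖.rng_inv u).symm)) := by
  classical
  refine (finsum_eq_single _ ⟨𝓖.mul g (𝓖.inv u) (h.trans (𝓖.rng_inv u).symm), 𝓖.rng_mul _ _ _⟩
    fun c hc => ?_).trans ?_
  · rw [Set.indicator_of_notMem, mul_zero]
    intro hcB
    have hcu := hB hcB hu ((𝓖.src_mul _ _ _).trans h)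
    refine hc (Subtype.ext ?_)
    have h1 := 𝓖.mul_inv_cancel_left c.1 g c.2 ((𝓖.src_inv _).trans c.2)
      ((𝓖.rng_mul _ _ _).trans (𝓖.rng_inv _)).symm
    simp only [hcu] at h1
    simp only [← h1]
    exact (𝓖.mul_mul_inv _ _ _ _).symm
  · have : 𝓖.mul (𝓖.inv (𝓖.mul g (𝓖.inv u) (h.trans (𝓖.rng_inv u).symm))) g
        ((𝓖.src_inv _).trans (𝓖.rng_mul _ _ _)) = u := by
      refine 𝓖.mul_left_cancel (g := 𝓖.mul g (𝓖.inv u) (h.trans (𝓖.rng_inv u).symm))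
        (h := (𝓖.rng_inv _).symm.trans (𝓖.rng_mul _ _ _).symm)
        (h' := (𝓖.src_mul _ _ _).trans (𝓖.src_inv u)) ?_
      rw [𝓖.mul_inv_cancel_left _ _ (𝓖.rng_mul _ _ _), 𝓖.mul_inv_mul]
    simp only [this]
    rw [Set.indicator_of_mem hu, Pi.one_apply, _root_.mul_one]

theorem conv_indicator_right_of_notMem (B : Set G) (f : G → ℤ) {g : G}
    (h : 𝓖.src g ∉ 𝓖.src '' B) : 𝓖.conv f (B.indicator 1) g = 0 := by
  refine (finsum_congr fun a => ?_).trans finsum_zero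
  rw [Set.indicator_of_notMem, mul_zero]
  exact fun ha => h ⟨_, ha, 𝓖.src_mul _ _ _⟩

theorem injOn_src_one (K : Set X) : Set.InjOn 𝓖.src (𝓖.one '' K) := by
  rintro _ ⟨x, -, rfl⟩ _ ⟨y, -, rfl⟩ h
  rw [𝓖.src_one, 𝓖.src_one] at h
  rw [h]

theorem src_image_one (K : Set X) : 𝓖.src '' (𝓖.one '' K) = K := by
  rw [Set.image_image]
  simp only [𝓖.src_one, Set.image_id']

theorem conv_indicator_one {K : Set X} (f : G → ℤ) {g : G} (h : 𝓖.src g ∈ K) :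
    𝓖.conv f ((𝓖.one '' K).indicator 1) g = f g := by
  rw [𝓖.conv_indicator_right (𝓖.injOn_src_one K) f (Set.mem_image_of_mem _ h) (𝓖.src_one _).symm]
  simp only [𝓖.inv_one, 𝓖.mul_one]

theorem conv_indicator_one_eq {K : Set X} {f : G → ℤ} (h : ∀ g, f g ≠ 0 → 𝓖.src g ∈ K) :
    𝓖.conv f ((𝓖.one '' K).indicator 1) = f := by
  funext g
  by_cases hg : 𝓖.src g ∈ K
  · exact 𝓖.conv_indicator_one f hg
  · rw [𝓖.conv_indicator_right_of_notMem _ _ (by rwa [𝓖.src_image_one])]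
    exact (not_not.1 fun hne => hg (h g hne)).symm

/-- This turns invariance into the linear equation `f * (1_B - 1_{s(B)}) = 0`. At an arrow `g u`
with `u ∈ B`, the left side evaluates `f` at `g` and the right side at `g u`; both sides vanish at
arrows with source outside `s(B)`. -/
theorem conv_indicator_eq_iff {B : Set G} (hB : Set.InjOn 𝓖.src B) (f : G → ℤ) :
    𝓖.conv f (B.indicator 1) = 𝓖.conv f ((𝓖.one '' (𝓖.src '' B)).indicator 1) ↔
      𝓖.IsRightInvariant f B := by
  constructor
  · intro hf u hu g h
    have h1 := congrFun hf (𝓖.mul g u h)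
    rw [𝓖.conv_indicator_right hB f hu (𝓖.src_mul _ _ _), 𝓖.conv_indicator_one, 𝓖.mul_mul_inv] at h1
    · exact h1.symm
    · exact ⟨u, hu, (𝓖.src_mul _ _ _).symm⟩
  · intro hf
    funext g
    by_cases hg : 𝓖.src g ∈ 𝓖.src '' B
    · obtain ⟨u, hu, h⟩ := hg
      rw [𝓖.conv_indicator_right hB f hu h.symm, 𝓖.conv_indicator_one _ (h ▸ Set.mem_image_of_mem _ hu)]
      rw [← hf u hu _ ((𝓖.src_mul _ _ _).trans (𝓖.src_inv u)), 𝓖.mul_inv_mul]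
    · rw [𝓖.conv_indicator_right_of_notMem _ _ hg, 𝓖.conv_indicator_right_of_notMem]
      rwa [𝓖.src_image_one]

end Algebra

/-! ### Fundamental domains of compact open principal subgroupoids. -/

section FundamentalDomain

variable [𝓖.IsAmple]

variable {𝓖} {H : Set G}

theorem isOpenMap_src : IsOpenMap 𝓖.src := (IsAmple.src_localHomeo (𝓖 := 𝓖)).isOpenMap

/-- Every unit has a compact open neighbourhood which meets every orbit of a given compact open
principal subgroupoid at most once. -/
theorem exists_section (hc : IsCompactOpen H)
    (hP : 𝓖.IsPrincipalOn H) (x : X) : ∃ V : Set X, IsCompact V ∧ IsOpen V ∧ x ∈ V ∧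
      ∀ h ∈ H, 𝓖.src h ∈ V → 𝓖.rng h ∈ V → h = 𝓖.one (𝓖.src h) := by
  have : T2Space X := IsAmple.t2 𝓖
  -- The non-unit arrows of `H` form a compact set, whose image under source and range is closed in
  -- `X × X` and misses `(x, x)` by principality. A small enough square around `(x, x)` avoids it.
  have h1 : IsCompact (H \ Set.range 𝓖.one) :=
    hc.isCompact.diff (𝓖.one_localHomeo.isOpenMap.isOpen_range)
  have h2 := (h1.image (𝓖.continuous_src.prodMk 𝓖.continuous_rng)).isClosed.isOpen_compl
  obtain ⟨U, V, hU, hV, hxU, hxV, hUV⟩ := isOpen_prod_iff.1 h2 x x (by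
    rintro ⟨h, ⟨hH, hn⟩, hx⟩
    obtain ⟨hx1, hx2⟩ := Prod.mk.inj hx
    exact hn ⟨_, (hP h hH (hx1.trans hx2.symm)).symm⟩)
  have hxUV : x ∈ U ∩ V := ⟨hxU, hxV⟩
  obtain ⟨K, hKc, hKo, hxK, hK⟩ := 𝓖.exists_compactOpen_unit (hU.inter hV) hxUV
  refine ⟨K, hKc, hKo, hxK, fun h hH hs hr => ?_⟩
  by_contra hn
  have hmem := hUV (Set.mk_mem_prod (hK hs).1 (hK hr).2)
  refine hmem ⟨h, ⟨hH, ?_⟩, rfl⟩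
  rintro ⟨y, rfl⟩
  rw [𝓖.src_one] at hn
  exact hn rfl

/-- A compact open principal subgroupoid has a compact open fundamental domain. -/
theorem exists_fundamentalDomain (hH : 𝓖.IsSubgroupoid H) (hc : IsCompactOpen H)
    (hP : 𝓖.IsPrincipalOn H) : ∃ D : Set X, IsCompact D ∧ IsOpen D ∧
      ∀ x, 𝓖.one x ∈ H → ∃ h ∈ H, 𝓖.src h = x ∧ 𝓖.rng h ∈ D ∧
        ∀ h' ∈ H, 𝓖.src h' = x → 𝓖.rng h' ∈ D → h' = h := by
  have : T2Space X := IsAmple.t2 𝓖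
  choose V hVc hVo hxV hV using exists_section hc hP
  obtain ⟨t, ht⟩ := (hc.isCompact.image 𝓖.continuous_src).elim_nhds_subcover V
    fun x _ => (hVo x).mem_nhds (hxV x)
  -- `D` is built up over a finite cover by the sets `V y`: it meets each orbit at most once and
  -- meets the orbit of every unit of `H` covered so far.
  have key : ∀ s : Finset X, ∃ D : Set X, IsCompact D ∧ IsOpen D ∧
      (∀ h ∈ H, 𝓖.src h ∈ D → 𝓖.rng h ∈ D → h = 𝓖.one (𝓖.src h)) ∧
      ∀ x, 𝓖.one x ∈ H → x ∈ ⋃ y ∈ s, V y → ∃ h ∈ H, 𝓖.src h = x ∧ 𝓖.rng h ∈ D := by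
    classical
    intro s
    induction s using Finset.induction_on with
    | empty => exact ⟨∅, isCompact_empty, isOpen_empty, fun _ _ h => h.elim, by simp⟩
    | insert a s ha ih =>
      obtain ⟨D, hDc, hDo, hD, hcov⟩ := ih
      -- The units whose orbit already meets `D`; only the part of `V a` outside this clopen set is
      -- added.
      let T := 𝓖.src '' (H ∩ 𝓖.rng ⁻¹' D)
      have hTc : IsCompact T := (hc.isCompact.inter_right
        (hDc.isClosed.preimage 𝓖.continuous_rng)).image 𝓖.continuous_src
      have hTo : IsOpen T := isOpenMap_src _ (hc.isOpen.inter (hDo.preimage 𝓖.continuous_rng))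
      refine ⟨D ∪ (V a \ T), hDc.union ((hVc a).diff hTo), hDo.union ((hVo a).sdiff hTc.isClosed),
        ?_, ?_⟩
      · rintro h hh (hs | hs) (hr | hr)
        · exact hD h hh hs hr
        · refine (hr.2 ⟨𝓖.inv h, ⟨hH.inv_mem h hh, ?_⟩, 𝓖.src_inv h⟩).elim
          rwa [Set.mem_preimage, 𝓖.rng_inv]
        · exact (hs.2 ⟨h, ⟨hh, hr⟩, rfl⟩).elim
        · exact hV a h hh hs.1 hr.1
      · intro x hx hxs
        by_cases hxT : x ∈ T
        · obtain ⟨h, ⟨hh, hr⟩, hs⟩ := hxT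
          exact ⟨h, hh, hs, Or.inl hr⟩
        rw [Finset.set_biUnion_insert] at hxs
        obtain hxa | hxs := hxs
        · exact ⟨_, hx, 𝓖.src_one x, Or.inr (by rw [𝓖.rng_one]; exact ⟨hxa, hxT⟩)⟩
        · obtain ⟨h, hh, hs, hr⟩ := hcov x hx hxs
          exact ⟨h, hh, hs, Or.inl hr⟩
  obtain ⟨D, hDc, hDo, hD, hcov⟩ := key t
  refine ⟨D, hDc, hDo, fun x hx => ?_⟩
  obtain ⟨h, hh, hs, hr⟩ := hcov x hx (ht.2 ⟨_, hx, 𝓖.src_one x⟩)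
  refine ⟨h, hh, hs, hr, fun h' hh' hs' hr' => ?_⟩
  -- The arrow `h' h⁻¹` joins two points of `D`, so it is a unit, and `h'` and `h` have the same
  -- range.
  have hc' : 𝓖.src h' = 𝓖.rng (𝓖.inv h) := by rw [𝓖.rng_inv, hs, hs']
  have hm := hH.mul_mem h' hh' _ (hH.inv_mem h hh) hc'
  have h1 := hD _ hm (by rwa [𝓖.src_mul, 𝓖.src_inv]) (by rwa [𝓖.rng_mul])
  refine hP.ext hH hh' hh (hs'.trans hs.symm) ?_
  have h2 := congrArg 𝓖.rng h1
  rwa [𝓖.rng_mul, 𝓖.rng_one, 𝓖.src_mul, 𝓖.src_inv] at h2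

/-- For a compact open principal subgroupoid `H` there is a function in `ℤ𝓖` which is invariant
under right multiplication by `H` and has sum `1` over the arrows starting at any unit of `H`. -/
theorem exists_invariant_of_isPrincipalOn (hH : 𝓖.IsSubgroupoid H) (hc : IsCompactOpen H)
    (hP : 𝓖.IsPrincipalOn H) : ∃ b ∈ compactOpenFun G, 𝓖.IsRightInvariant b H ∧
      ∀ x, 𝓖.one x ∈ H → 𝓖.act 1 b x = 1 := by
  classical
  have : T2Space X := IsAmple.t2 𝓖
  obtain ⟨D, hDc, hDo, hD⟩ := exists_fundamentalDomain hH hc hP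
  have : T2Space H := hc.t2
  -- Right multiplication by `H` changes neither the range nor membership in `H`, whence the
  -- invariance; the fibre sum counts the unique arrow of `H` from `x` into `D`.
  refine ⟨(H ∩ 𝓖.rng ⁻¹' D).indicator 1, AddSubgroup.subset_closure ⟨_, ⟨hc.isCompact.inter_right
    (hDc.isClosed.preimage 𝓖.continuous_rng),
    T2Space.of_injective_continuous (Set.inclusion_injective Set.inter_subset_left)
      (continuous_inclusion Set.inter_subset_left), hc.isOpen.inter
        (hDo.preimage 𝓖.continuous_rng)⟩, rfl⟩, fun u hu g h => ?_, fun x hx => ?_⟩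
  · simp only [Set.indicator_apply, Set.mem_inter_iff, Set.mem_preimage, 𝓖.rng_mul,
      hH.mul_mem_iff hu, Pi.one_apply]
  · obtain ⟨h, hh, hs, hr, hu⟩ := hD x hx
    refine (finsum_eq_single _ ⟨h, hs⟩ fun c hc => ?_).trans ?_
    · rw [Set.indicator_of_notMem (a := c.1), mul_zero]
      exact fun hcm => hc (Subtype.ext (hu _ hcm.1 c.2 hcm.2))
    · rw [Set.indicator_of_mem (show h ∈ H ∩ 𝓖.rng ⁻¹' D from ⟨hh, hr⟩)]
      rfl

end FundamentalDomain

end TopGroupoid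

end AmpleHomology

namespace AmpleHomology

namespace TopGroupoid

variable {X G : Type u} [TopologicalSpace X] [TopologicalSpace G] (𝓖 : TopGroupoid X G)

/-! ### The subgroupoid generated by a set of arrows, and when its powers stabilize. -/

section Generation

/-- The products of `n + 1` arrows in `W`. -/
def powSet (W : Set G) : ℕ → Set G
  | 0 => W
  | n + 1 => 𝓖.mulSet (powSet W n) W

theorem inv_mul_rev (g h : G) (e : 𝓖.src g = 𝓖.rng h) :
    𝓖.inv (𝓖.mul g h e) = 𝓖.mul (𝓖.inv h) (𝓖.inv g)
      ((𝓖.src_inv h).trans (e.symm.trans (𝓖.rng_inv g).symm)) := by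
  refine 𝓖.mul_left_cancel (g := 𝓖.mul g h e) (h := (𝓖.rng_inv _).symm)
    (h' := ((𝓖.src_mul _ _ _).trans (𝓖.rng_inv h).symm).trans (𝓖.rng_mul _ _ _).symm) ?_
  rw [𝓖.mul_inv, ← 𝓖.mul_assoc (𝓖.mul g h e) (𝓖.inv h) (𝓖.inv g)
    ((𝓖.src_mul _ _ _).trans (𝓖.rng_inv h).symm), 𝓖.rng_mul]
  simp only [𝓖.mul_mul_inv, 𝓖.mul_inv]

variable {𝓖} {W : Set G}

theorem one_src_mem_of_mem_powSet (hs : ∀ w ∈ W, 𝓖.one (𝓖.src w) ∈ W) :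
    ∀ n, ∀ g ∈ 𝓖.powSet W n, 𝓖.one (𝓖.src g) ∈ W
  | 0, g, hg => hs g hg
  | n + 1, _, ⟨a, _, w, hw, _, h⟩ => by
    rw [← h, 𝓖.src_mul]
    exact hs w hw

theorem powSet_subset_succ (hs : ∀ w ∈ W, 𝓖.one (𝓖.src w) ∈ W) (n : ℕ) :
    𝓖.powSet W n ⊆ 𝓖.powSet W (n + 1) := fun g hg =>
  ⟨g, hg, _, one_src_mem_of_mem_powSet hs n g hg, (𝓖.rng_one _).symm, 𝓖.mul_one g⟩

/-- The index `n` stands for `n + 1` factors, which accounts for the extra 1. -/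
theorem mulSet_powSet (n m : ℕ) :
    𝓖.mulSet (𝓖.powSet W n) (𝓖.powSet W m) = 𝓖.powSet W (n + m + 1) := by
  induction m with
  | zero => rfl
  | succ m ih =>
    change 𝓖.mulSet _ (𝓖.mulSet _ W) = 𝓖.mulSet (𝓖.powSet W (n + m + 1)) W
    rw [← ih, 𝓖.mulSet_assoc]

theorem inv_mem_powSet (hi : ∀ w ∈ W, 𝓖.inv w ∈ W) (n : ℕ) :
    ∀ g ∈ 𝓖.powSet W n, 𝓖.inv g ∈ 𝓖.powSet W n := by
  induction n with
  | zero => exact hi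
  | succ n ih =>
    rintro _ ⟨a, ha, w, hw, h, rfl⟩
    -- Inversion moves the last factor to the front, so the power has to be split as `W` times the
    -- lower power.
    rw [𝓖.inv_mul_rev, ← Nat.zero_add n, ← mulSet_powSet]
    exact ⟨_, hi w hw, _, ih a ha, _, rfl⟩

/-- The subgroupoid generated by a symmetric set of arrows containing its units. -/
theorem isSubgroupoid_iUnion_powSet (hi : ∀ w ∈ W, 𝓖.inv w ∈ W) :
    𝓖.IsSubgroupoid (⋃ n, 𝓖.powSet W n) := by
  constructor
  · intro g hg h hh e
    obtain ⟨n, hn⟩ := Set.mem_iUnion.1 hg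
    obtain ⟨m, hm⟩ := Set.mem_iUnion.1 hh
    refine Set.mem_iUnion.2 ⟨n + m + 1, ?_⟩
    rw [← mulSet_powSet]
    exact ⟨g, hn, h, hm, e, rfl⟩
  · intro g hg
    obtain ⟨n, hn⟩ := Set.mem_iUnion.1 hg
    exact Set.mem_iUnion.2 ⟨n, inv_mem_powSet hi n g hn⟩

theorem IsRightInvariant.powSet {b : G → ℤ} (hb : 𝓖.IsRightInvariant b W) (n : ℕ) :
    𝓖.IsRightInvariant b (𝓖.powSet W n) := by
  induction n with
  | zero => exact hb
  | succ n ih =>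
    rintro _ ⟨a, ha, w, hw, e, rfl⟩ g h
    rw [← 𝓖.mul_assoc g a w (h.trans (𝓖.rng_mul _ _ _)) e, hb w hw, ih a ha]

theorem isRightInvariant_iUnion_powSet {b : G → ℤ} (hb : 𝓖.IsRightInvariant b W) :
    𝓖.IsRightInvariant b (⋃ n, 𝓖.powSet W n) := fun u hu g h => by
  obtain ⟨n, hn⟩ := Set.mem_iUnion.1 hu
  exact hb.powSet n u hn g h

variable (𝓖) in
/-- The stars of the powers of `W` are stable as soon as their size is bounded. -/
theorem iUnion_powSet_eq {m : ℕ} (hs : ∀ w ∈ W, 𝓖.one (𝓖.src w) ∈ W)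
    (h : ∀ x, {g ∈ ⋃ n, 𝓖.powSet W n | 𝓖.rng g = x}.encard ≤ m) :
    ⋃ n, 𝓖.powSet W n = 𝓖.powSet W m := by
  refine Set.Subset.antisymm (Set.iUnion_subset fun n g hg => ?_) (Set.subset_iUnion _ m)
  -- The part of the star at the range of `g` which is reached by the `k`-th power.
  let S : ℕ → Set G := fun k => {g' ∈ 𝓖.powSet W k | 𝓖.rng g' = 𝓖.rng g}
  have hS : ∀ k, S k ⊆ {g' ∈ ⋃ n, 𝓖.powSet W n | 𝓖.rng g' = 𝓖.rng g} := fun k g' hg' =>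
    ⟨Set.mem_iUnion.2 ⟨k, hg'.1⟩, hg'.2⟩
  have hcard : ∀ k, (S k).encard ≤ m := fun k => (Set.encard_le_encard (hS k)).trans (h _)
  have hfin : ∀ k, (S k).Finite := fun k => Set.finite_of_encard_le_coe (hcard k)
  have hmono : Monotone S := monotone_nat_of_le_succ fun k g' hg' =>
    ⟨powSet_subset_succ hs k hg'.1, hg'.2⟩
  have hncard : ∀ k, (S k).ncard ≤ m := fun k => by
    have := hcard k
    rw [← (hfin k).cast_ncard_eq] at this
    exact_mod_cast this
  -- Once two consecutive sets agree, the growth stops: an arrow of `S (k + 2)` is one of `S (k + 1)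
  -- = S k` times an element of `W`.
  have hstab : ∀ k, (S k).ncard = (S (k + 1)).ncard → (S (k + 1)).ncard = (S (k + 2)).ncard := by
    intro k hk
    have hk' := Set.eq_of_subset_of_ncard_le (hmono k.le_succ) hk.ge (hfin _)
    congr 1
    refine (hmono (k + 1).le_succ).antisymm ?_
    rintro _ ⟨⟨a, ha, w, hw, e, rfl⟩, hr⟩
    rw [𝓖.rng_mul] at hr
    have ha' : a ∈ S k := hk' ▸ (⟨ha, hr⟩ : a ∈ S (k + 1))
    exact ⟨⟨a, ha'.1, w, hw, e, rfl⟩, (𝓖.rng_mul _ _ _).trans hr⟩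
  -- Sizes bounded by `m` that never resume growing are constant from index `m` on; this index is
  -- the same for all units.
  have key : (S (max m n)).ncard = (S m).ncard :=
    Nat.stabilises_of_monotone (f := fun k => (S k).ncard)
      (fun i j hij => Set.ncard_le_ncard (hmono hij) (hfin j)) hncard hstab (le_max_left m n)
  have heq := Set.eq_of_subset_of_ncard_le (hmono (le_max_left m n)) key.le (hfin _)
  have hgS : g ∈ S (max m n) := hmono (le_max_right m n) (⟨hg, rfl⟩ : g ∈ S n)
  rw [← heq] at hgS
  exact hgS.1

end Generation

/-! ### Trivial isotropy and compactness from an invariant function. -/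

section Isotropy

variable {𝓖} in
theorem exists_ne_zero_of_act_eq_one {b : G → ℤ} {x : X} (h : 𝓖.act 1 b x = 1) :
    ∃ a, 𝓖.src a = x ∧ b a ≠ 0 := by
  by_contra! hn
  refine one_ne_zero (h.symm.trans ((finsum_congr fun a => ?_).trans finsum_zero))
  rw [hn a.1 a.2, mul_zero]

variable {𝓖} in
/-- The size of a star of `H` is bounded by the size of a fibre of the support of a function which
is invariant under `H`. -/
theorem IsRightInvariant.encard_star_le {H : Set G} {b : G → ℤ} {x : X}
    (hb : 𝓖.IsRightInvariant b H) {m : ℕ}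
    (hm : ∀ x, {a : G | 𝓖.rng a = x ∧ b a ≠ 0}.encard ≤ m) (h : 𝓖.act 1 b x = 1) :
    {g ∈ H | 𝓖.rng g = x}.encard ≤ m := by
  classical
  obtain ⟨a, rfl, ha⟩ := exists_ne_zero_of_act_eq_one h
  -- Translation `g ↦ a g` embeds the star at the source of `a` in the support of `b` over the range
  -- of `a`. The default value `g` never occurs on the star.
  refine le_trans (Set.encard_le_encard_of_injOn
    (f := fun g => if e : 𝓖.src a = 𝓖.rng g then 𝓖.mul a g e else g) ?_ ?_) (hm (𝓖.rng a))
  · rintro g ⟨hg, e⟩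
    simp only [dif_pos e.symm]
    exact ⟨𝓖.rng_mul _ _ _, by rwa [hb g hg]⟩
  · rintro g ⟨hg, e⟩ g' ⟨hg', e'⟩ heq
    simp only [dif_pos e.symm, dif_pos e'.symm] at heq
    exact 𝓖.mul_left_cancel heq

variable [𝓖.IsAmple]

/-- The bound is uniform in `x`: `f` is a finite combination of characteristic functions of
bisections, each of which has at most one arrow in each range fibre. -/
theorem exists_encard_rng_fiber_le {f : G → ℤ} (hf : f ∈ compactOpenFun G) :
    ∃ m : ℕ, ∀ x, {a : G | 𝓖.rng a = x ∧ f a ≠ 0}.encard ≤ m := by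
  refine 𝓖.compactOpenFun_induction
    (p := fun f => ∃ m : ℕ, ∀ x, {a : G | 𝓖.rng a = x ∧ f a ≠ 0}.encard ≤ m) ?_ ?_ ?_ ?_ hf
  · intro B hB
    refine ⟨1, fun x => Set.encard_le_one_iff.2 fun a b ha hb => ?_⟩
    exact hB.rng_inj (Set.mem_of_indicator_ne_zero ha.2) (Set.mem_of_indicator_ne_zero hb.2)
      (ha.1.trans hb.1.symm)
  · exact ⟨0, fun x => by simp⟩
  · rintro f h _ _ ⟨m, hm⟩ ⟨k, hk⟩
    refine ⟨m + k, fun x => ?_⟩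
    rw [Nat.cast_add]
    refine le_trans (Set.encard_le_encard ?_)
      ((Set.encard_union_le _ _).trans (add_le_add (hm x) (hk x)))
    intro a ha
    by_contra hn
    simp only [Set.mem_union, Set.mem_ofPred_eq, not_or, not_and, not_not] at hn
    exact ha.2 (by simp [hn.1 ha.1, hn.2 ha.1])
  · rintro f _ ⟨m, hm⟩
    exact ⟨m, fun x => by simpa using hm x⟩

variable {𝓖} {H : Set G} {b : G → ℤ} {x : X}

/-- If a function with sum `1` over the arrows starting at `x` is invariant under a subgroupoid,
then the latter has trivial isotropy at `x`. -/
theorem IsRightInvariant.eq_one_of_src_eq_rng (hH : 𝓖.IsSubgroupoid H)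
    (hb : 𝓖.IsRightInvariant b H) (hbm : b ∈ compactOpenFun G) (h : 𝓖.act 1 b x = 1) {g : G}
    (hg : g ∈ H) (hs : 𝓖.src g = x) (hr : 𝓖.rng g = x) : g = 𝓖.one x := by
  classical
  have hx : 𝓖.one x ∈ H := hs ▸ hH.one_src_mem hg
  let Γ : Set G := {h ∈ H | 𝓖.src h = x ∧ 𝓖.rng h = x}
  -- An arrow of `H` relating two arrows with source `x` lies in the isotropy group `Γ`, so the
  -- classes are the orbits of `Γ`, acting freely from the right.
  let R : Setoid {a : G // 𝓖.src a = x} :=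
    { r := fun a a' => ∃ h ∈ H, ∃ e, 𝓖.mul a h e = a'
      iseqv :=
        ⟨fun a => ⟨_, hx, a.2.trans (𝓖.rng_one x).symm, 𝓖.mul_one_of_eq _ _⟩, by
          rintro a a' ⟨h, hh, e, e'⟩
          refine ⟨_, hH.inv_mem h hh, ?_, ?_⟩
          · rw [← e', 𝓖.src_mul, 𝓖.rng_inv]
          · simp only [← e']
            exact 𝓖.mul_mul_inv _ _ _ _, by
          rintro a a' a'' ⟨h, hh, e, e'⟩ ⟨k, hk, f, f'⟩
          have hc : 𝓖.src h = 𝓖.rng k := by rw [← f, ← e', 𝓖.src_mul]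
          refine ⟨_, hH.mul_mem h hh k hk hc, e.trans (𝓖.rng_mul _ _ _).symm, ?_⟩
          rw [← 𝓖.mul_assoc _ _ _ e hc, ← f']
          simp only [e']⟩ }
  have hsum : ∑ a ∈ (𝓖.act_support 1 hbm x).toFinset, (1 : X → ℤ) (𝓖.rng a.1) * b a.1 = 1 :=
    (finsum_eq_sum _ (𝓖.act_support 1 hbm x)).symm.trans h
  -- `b` is constant on each orbit, and an orbit that meets its support lies in it and has as many
  -- elements as `Γ`. An infinite `Γ` would have `ncard` 0, which does not divide 1 either.
  have hdvd : (Γ.ncard : ℤ) ∣ 1 := by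
    rw [← hsum, Finset.sum_partition R]
    refine Finset.dvd_sum fun c hc => ?_
    obtain ⟨a, ha, rfl⟩ := Finset.mem_image.1 hc
    rw [Finset.sum_congr rfl (g := fun _ => b a.1), Finset.sum_const, nsmul_eq_mul]
    · refine Dvd.intro _ (congrArg (· * _) (congrArg Nat.cast ?_))
      rw [← Set.ncard_coe_finset]
      refine Set.ncard_congr (fun h hh => ⟨𝓖.mul a.1 h (a.2.trans hh.2.2.symm),
        (𝓖.src_mul _ _ _).trans hh.2.1⟩) ?_ ?_ ?_
      · rintro h ⟨hh, hs, hr⟩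
        simp only [Finset.coe_filter, Set.mem_ofPred_eq, Set.Finite.mem_toFinset,
          Function.mem_support, Pi.one_apply, _root_.one_mul] at ha ⊢
        exact ⟨by rwa [hb h hh], (Quotient.sound (s := R) (a := a)
          (show R.r a _ from ⟨h, hh, a.2.trans hr.symm, rfl⟩)).symm⟩
      · intro h k hh hk heq
        exact 𝓖.mul_left_cancel (Subtype.ext_iff.1 heq)
      · intro a' ha'
        simp only [Finset.coe_filter, Set.mem_ofPred_eq] at ha'
        obtain ⟨k, hk, e, e'⟩ : R.r a a' := Quotient.exact ha'.2.symm
        refine ⟨k, ⟨hk, ?_, e.symm.trans a.2⟩, Subtype.ext e'⟩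
        rw [← a'.2, ← e', 𝓖.src_mul]
    · intro a' ha'
      obtain ⟨k, hk, e, e'⟩ : R.r a a' := Quotient.exact (Finset.mem_filter.1 ha').2.symm
      rw [← e', hb k hk, Pi.one_apply, _root_.one_mul]
  obtain ⟨k, hk⟩ := Set.ncard_eq_one.1 (Nat.dvd_one.1 (by exact_mod_cast hdvd))
  have h1 : g ∈ Γ := ⟨hg, hs, hr⟩
  have h2 : 𝓖.one x ∈ Γ := ⟨hx, 𝓖.src_one x, 𝓖.rng_one x⟩
  rw [hk] at h1 h2
  exact h1.trans h2.symm

variable {W : Set G}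

/-- If there is an invariant function with fibre sums `1` for a compact open symmetric set of
arrows, then this set generates a compact open principal subgroupoid. -/
theorem exists_subgroupoid_of_isRightInvariant (hWc : IsCompact W) (hWo : IsOpen W)
    (hi : ∀ w ∈ W, 𝓖.inv w ∈ W) (hu : ∀ w ∈ W, 𝓖.one (𝓖.src w) ∈ W)
    (hb : 𝓖.IsRightInvariant b W) (hbm : b ∈ compactOpenFun G)
    (h : ∀ x, 𝓖.one x ∈ W → 𝓖.act 1 b x = 1) :
    ∃ H, W ⊆ H ∧ 𝓖.IsSubgroupoid H ∧ IsCompactOpen H ∧ 𝓖.IsPrincipalOn H := by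
  have : T2Space X := IsAmple.t2 𝓖
  have hH := isSubgroupoid_iUnion_powSet hi
  have hbH := isRightInvariant_iUnion_powSet hb
  have hsrc : ∀ g ∈ ⋃ n, 𝓖.powSet W n, 𝓖.one (𝓖.src g) ∈ W := fun g hg => by
    obtain ⟨n, hn⟩ := Set.mem_iUnion.1 hg
    exact one_src_mem_of_mem_powSet hu n g hn
  have hP : 𝓖.IsPrincipalOn (⋃ n, 𝓖.powSet W n) := fun g hg hgr =>
    hbH.eq_one_of_src_eq_rng hH hbm (h _ (hsrc g hg)) hg rfl hgr.symm
  obtain ⟨m, hm⟩ := 𝓖.exists_encard_rng_fiber_le hbm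
  -- At units outside `W` the star is empty, because every unit of the generated subgroupoid lies in
  -- `W`.
  have heq := 𝓖.iUnion_powSet_eq hu (m := m) fun x => by
    by_cases hx : 𝓖.one x ∈ W
    · exact hbH.encard_star_le hm (h x hx)
    · rw [Set.encard_eq_zero.2]
      · exact zero_le
      · refine Set.eq_empty_of_forall_notMem fun g hg => hx ?_
        rw [← hg.2, ← 𝓖.src_inv]
        exact hsrc _ (hH.inv_mem g hg.1)
  have hpow : ∀ n, IsCompact (𝓖.powSet W n) ∧ IsOpen (𝓖.powSet W n) := fun n => by
    induction n with
    | zero => exact ⟨hWc, hWo⟩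
    | succ n ih => exact ⟨𝓖.isCompact_mulSet ih.1 hWc, 𝓖.isOpen_mulSet ih.2 hWo⟩
  refine ⟨_, Set.subset_iUnion (𝓖.powSet W) 0, hH, ⟨?_, ?_, ?_⟩, hP⟩
  · rw [heq]
    exact (hpow m).1
  -- `G` need not be Hausdorff, but principality makes source and range together injective into the
  -- Hausdorff space `X × X`.
  · refine T2Space.of_injective_continuous (f := fun g : ↥(⋃ n, 𝓖.powSet W n) =>
      (𝓖.src g.1, 𝓖.rng g.1)) (fun g g' e => Subtype.ext ?_)
      ((𝓖.continuous_src.prodMk 𝓖.continuous_rng).comp continuous_subtype_val)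
    exact hP.ext hH g.2 g'.2 (Prod.mk.inj e).1 (Prod.mk.inj e).2
  · rw [heq]
    exact (hpow m).2

end Isotropy

end TopGroupoid

end AmpleHomology

namespace AmpleHomology

theorem exists_eq_zsmul_add_incl {A : Type u} [NonUnitalRing A] (s : AdjoinUnit A) :
    ∃ (k : ℤ) (a : A), s = k • 1 + incl a := by
  refine ⟨s.toProd.1, s.toProd.2, Unitization.ext ?_ ?_⟩
  · change s.toProd.1 = s.toProd.1 • (1 : ℤ) + 0
    rw [smul_eq_mul, mul_one, add_zero]
  · change s.toProd.2 = s.toProd.1 • (0 : A) + s.toProd.2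
    rw [smul_zero, zero_add]

namespace TopGroupoid

variable {X G : Type u} [TopologicalSpace X] [TopologicalSpace G] (𝓖 : TopGroupoid X G)

/-! ### Functions on the unit space as elements of ℤ𝓖. -/

section Diagonal

/-- The extension by zero of a function on the unit space to the space of arrows. -/
noncomputable def diagFun (n : X → ℤ) : G → ℤ :=
  (Set.range 𝓖.one).indicator (n ∘ 𝓖.rng)

theorem diagFun_one (n : X → ℤ) (x : X) : 𝓖.diagFun n (𝓖.one x) = n x := by
  rw [diagFun, Set.indicator_of_mem (Set.mem_range_self x), Function.comp_apply, 𝓖.rng_one]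

theorem diagFun_of_notMem (n : X → ℤ) {g : G} (hg : g ∉ Set.range 𝓖.one) :
    𝓖.diagFun n g = 0 :=
  Set.indicator_of_notMem hg _

theorem diagFun_add (n n' : X → ℤ) : 𝓖.diagFun (n + n') = 𝓖.diagFun n + 𝓖.diagFun n' :=
  Set.indicator_add' _ _ _

theorem diagFun_indicator (K : Set X) :
    𝓖.diagFun (K.indicator 1) = (𝓖.one '' K).indicator 1 := by
  classical
  funext g
  by_cases hg : g ∈ Set.range 𝓖.one
  · obtain ⟨x, rfl⟩ := hg
    have hinj : Function.Injective 𝓖.one := Function.LeftInverse.injective 𝓖.src_one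
    rw [diagFun_one, Set.indicator_apply, Set.indicator_apply, hinj.mem_set_image]
    rfl
  · rw [diagFun_of_notMem _ _ hg, Set.indicator_of_notMem]
    exact fun h => hg (Set.image_subset_range _ _ h)

theorem conv_diagFun (n : X → ℤ) (f : G → ℤ) (g : G) :
    𝓖.conv (𝓖.diagFun n) f g = n (𝓖.rng g) * f g := by
  refine (finsum_eq_single _ ⟨𝓖.one (𝓖.rng g), 𝓖.rng_one _⟩ fun c hc => ?_).trans ?_
  · rw [diagFun_of_notMem, zero_mul]
    rintro ⟨x, hx⟩
    refine hc (Subtype.ext ?_)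
    have h2 := c.2
    rw [← hx, 𝓖.rng_one] at h2
    rw [← hx, h2]
  · simp only [diagFun_one, 𝓖.inv_one, 𝓖.one_mul]

theorem act_diagFun (h n : X → ℤ) (x : X) : 𝓖.act h (𝓖.diagFun n) x = h x * n x := by
  refine (finsum_eq_single _ ⟨𝓖.one x, 𝓖.src_one _⟩ fun c hc => ?_).trans ?_
  · rw [diagFun_of_notMem, mul_zero]
    rintro ⟨y, hy⟩
    refine hc (Subtype.ext ?_)
    have h2 := c.2
    rw [← hy, 𝓖.src_one] at h2
    rw [← hy, h2]
  · simp only [diagFun_one, 𝓖.rng_one]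

/-- This absorbs a coefficient `n` into the ring element, so that a sum of terms `n b` becomes the
action of a single ring element on the constant function 1. That function need not lie in ℤ𝓖⁰, which
is why `act` is used on arbitrary functions. -/
theorem act_one_conv_diagFun (n : X → ℤ) (f : G → ℤ) :
    𝓖.act 1 (𝓖.conv (𝓖.diagFun n) f) = 𝓖.act n f := by
  funext x
  refine finsum_congr fun g => ?_
  rw [conv_diagFun, Pi.one_apply, _root_.one_mul]

theorem diagFun_zero : 𝓖.diagFun 0 = 0 :=
  Set.indicator_zero _ _

theorem diagFun_neg (n : X → ℤ) : 𝓖.diagFun (-n) = -𝓖.diagFun n :=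
  Set.indicator_neg' _ _

variable [𝓖.IsAmple]

theorem diagFun_mem {n : X → ℤ} (hn : n ∈ compactOpenFun X) :
    𝓖.diagFun n ∈ compactOpenFun G := by
  induction hn using AddSubgroup.closure_induction with
  | mem n hn =>
    obtain ⟨K, hK, rfl⟩ := hn
    rw [diagFun_indicator]
    exact 𝓖.indicator_mem (𝓖.isCompactBisection_one hK.isCompact hK.isOpen)
  | zero =>
    rw [diagFun_zero]
    exact zero_mem _
  | add n n' _ _ ih ih' => rw [diagFun_add]; exact add_mem ih ih'
  | neg n _ ih =>
    rw [diagFun_neg]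
    exact neg_mem ih

/-- The inclusion `ℤ𝓖⁰ → ℤ𝓖`. -/
noncomputable def diag : 𝓖.Triv →+ 𝓖.Alg :=
  AddMonoidHom.mk' (fun n => ⟨𝓖.diagFun n.1, 𝓖.diagFun_mem n.2⟩)
    fun n n' => Subtype.ext (𝓖.diagFun_add n.1 n'.1)

theorem op_incl_smul (a : 𝓖.Alg) (n : 𝓖.Triv) :
    MulOpposite.op (incl a) • n = 𝓖.trivAct n a := by
  change (0 : ℤ) • n + 𝓖.trivAct n a = _
  rw [zero_smul, zero_add]

theorem isCompactOpen_unit (𝓖 : TopGroupoid X G) [𝓖.IsAmple] {K : Set X}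
    (hK : IsCompact K) (hKo : IsOpen K) : IsCompactOpen K :=
  have : T2Space X := IsAmple.t2 𝓖
  ⟨hK, inferInstance, hKo⟩

/-- The characteristic function of a compact open set of units. -/
noncomputable def unitInd {K : Set X} (hK : IsCompactOpen K) : 𝓖.Triv :=
  ⟨K.indicator 1, AddSubgroup.subset_closure ⟨K, hK, rfl⟩⟩

/-- The characteristic function of a compact bisection. -/
noncomputable def bisInd {B : Set G} (hB : 𝓖.IsCompactBisection B) : 𝓖.Alg :=
  ⟨B.indicator 1, 𝓖.indicator_mem hB⟩

theorem exists_support_unit (𝓖 : TopGroupoid X G) [𝓖.IsAmple] {n : X → ℤ} (hn : n ∈ compactOpenFun X) :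
    ∃ K : Set X, IsCompactOpen K ∧ ∀ x, n x ≠ 0 → x ∈ K := by
  obtain ⟨K, hK, hKo, h⟩ := 𝓖.exists_unit_support (𝓖.diagFun_mem hn)
  refine ⟨K, 𝓖.isCompactOpen_unit hK hKo, fun x hx => ?_⟩
  rw [← 𝓖.rng_one x]
  exact h _ (by rwa [diagFun_one])

/-- A function on the unit space is a multiple of the characteristic function of any set which
contains its support. -/
theorem op_incl_diag_smul_unitInd {K : Set X} (hK : IsCompactOpen K) (n : 𝓖.Triv)
    (h : ∀ x, n.1 x ≠ 0 → x ∈ K) : MulOpposite.op (incl (𝓖.diag n)) • 𝓖.unitInd hK = n := by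
  rw [op_incl_smul]
  refine Subtype.ext (funext fun x => ?_)
  refine (𝓖.act_diagFun (K.indicator 1) n.1 x).trans ?_
  by_cases hx : n.1 x = 0
  · rw [hx, mul_zero]
  · rw [Set.indicator_of_mem (h x hx), Pi.one_apply, _root_.one_mul]

theorem diag_unitInd_mul {K : Set X} (hK : IsCompactOpen K) (f : 𝓖.Alg)
    (h : ∀ g, f.1 g ≠ 0 → 𝓖.rng g ∈ K) : 𝓖.diag (𝓖.unitInd hK) * f = f :=
  Subtype.ext ((congrArg (𝓖.conv · f.1) (𝓖.diagFun_indicator K)).trans (𝓖.conv_one h))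

theorem mul_diag_unitInd {K : Set X} (hK : IsCompactOpen K) (f : 𝓖.Alg)
    (h : ∀ g, f.1 g ≠ 0 → 𝓖.src g ∈ K) : f * 𝓖.diag (𝓖.unitInd hK) = f :=
  Subtype.ext ((congrArg (𝓖.conv f.1) (𝓖.diagFun_indicator K)).trans (𝓖.conv_indicator_one_eq h))

theorem mem_of_diag_unitInd_ne_zero {K : Set X} (hK : IsCompactOpen K) {g : G}
    (h : (𝓖.diag (𝓖.unitInd hK)).1 g ≠ 0) : ∃ x ∈ K, 𝓖.one x = g := by
  have h' : 𝓖.diagFun (K.indicator 1) g ≠ 0 := h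
  rw [diagFun_indicator] at h'
  exact (Set.mem_of_indicator_ne_zero h' : g ∈ 𝓖.one '' K)

theorem trivAct_bisInd {K : Set X} (hK : IsCompactOpen K) {B : Set G}
    (hB : 𝓖.IsCompactBisection B) (hBK : IsCompactOpen (𝓖.src '' B))
    (h : ∀ g ∈ B, 𝓖.rng g ∈ K) : 𝓖.trivAct (𝓖.unitInd hK) (𝓖.bisInd hB) = 𝓖.unitInd hBK := by
  refine Subtype.ext ((𝓖.act_indicator K hB.src_inj).trans ?_)
  have hBK' : B ∩ 𝓖.rng ⁻¹' K = B := Set.inter_eq_left.2 h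
  rw [hBK']
  rfl

theorem trivAct_diag_unitInd {K L : Set X} (hK : IsCompactOpen K) (hL : IsCompactOpen L)
    (h : L ⊆ K) : 𝓖.trivAct (𝓖.unitInd hK) (𝓖.diag (𝓖.unitInd hL)) = 𝓖.unitInd hL := by
  rw [← 𝓖.op_incl_smul, 𝓖.op_incl_diag_smul_unitInd hK]
  exact fun x hx => h (Set.mem_of_indicator_ne_zero hx)

end Diagonal

/-! ### AF groupoids have vanishing higher homology. -/

section Flatness

variable [𝓖.IsAmple]

open TensorProduct

/-- Every element of `ℤ𝓖⁰ ⊗ M` is a pure tensor with a characteristic function. -/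
theorem exists_eq_tmul_unitInd {M : Type u} [AddCommGroup M] [Module (AdjoinUnit 𝓖.Alg) M]
    (t : BalancedTensor (AdjoinUnit 𝓖.Alg) 𝓖.Triv M) :
    ∃ (K : Set X) (hK : IsCompactOpen K) (m : M), t = BalancedTensor.tmul (𝓖.unitInd hK) m := by
  -- Allowing every larger `K` lets two summands share their first factor.
  suffices h : ∃ K₀ : Set X, IsCompactOpen K₀ ∧ ∀ (K : Set X) (hK : IsCompactOpen K), K₀ ⊆ K →
      ∃ m : M, t = BalancedTensor.tmul (𝓖.unitInd hK) m by
    obtain ⟨K, hK, h⟩ := h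
    exact ⟨K, hK, h K hK subset_rfl⟩
  induction t using BalancedTensor.induction_on with
  | zero =>
    exact ⟨∅, 𝓖.isCompactOpen_unit isCompact_empty isOpen_empty,
      fun _ _ _ => ⟨0, (BalancedTensor.tmul_zero _).symm⟩⟩
  | tmul n m =>
    obtain ⟨K₀, hK₀, h⟩ := 𝓖.exists_support_unit n.2
    refine ⟨K₀, hK₀, fun K hK hKK => ⟨incl (𝓖.diag n) • m, ?_⟩⟩
    rw [← BalancedTensor.smul_tmul, 𝓖.op_incl_diag_smul_unitInd hK n fun x hx => hKK (h x hx)]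
  | add t t' ih ih' =>
    obtain ⟨K, hK, h⟩ := ih
    obtain ⟨K', hK', h'⟩ := ih'
    refine ⟨K ∪ K', 𝓖.isCompactOpen_unit (hK.isCompact.union hK'.isCompact)
      (hK.isOpen.union hK'.isOpen), fun L hL hLK => ?_⟩
    obtain ⟨m, rfl⟩ := h L hL (Set.subset_union_left.trans hLK)
    obtain ⟨m', rfl⟩ := h' L hL (Set.subset_union_right.trans hLK)
    exact ⟨m + m', (BalancedTensor.tmul_add _ _ _).symm⟩

/-- Multiplication by a function which is invariant under sufficiently many arrows identifies an
element of `ℤ𝓖` with its image in `ℤ𝓖⁰`. -/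
theorem exists_compact_mul_diag_eq (n : 𝓖.Triv) (a : 𝓖.Alg) :
    ∃ C : Set G, IsCompact C ∧ ∀ b : 𝓖.Alg, 𝓖.IsRightInvariant b.1 C →
      b * 𝓖.diag (𝓖.trivAct n a) = b * (𝓖.diag n * a) := by
  have : T2Space X := IsAmple.t2 𝓖
  have mono : ∀ {b : G → ℤ} {C C' : Set G}, C ⊆ C' → 𝓖.IsRightInvariant b C' →
    𝓖.IsRightInvariant b C := fun h hb u hu => hb u (h hu)
  obtain ⟨a, ha⟩ := a
  obtain ⟨n, hn⟩ := n
  suffices key : ∃ C : Set G, IsCompact C ∧ ∀ b ∈ compactOpenFun G, 𝓖.IsRightInvariant b C →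
      𝓖.conv b (𝓖.diagFun (𝓖.act n a)) = 𝓖.conv b (𝓖.conv (𝓖.diagFun n) a) by
    obtain ⟨C, hC, h⟩ := key
    exact ⟨C, hC, fun b hb => Subtype.ext (h b.1 b.2 hb)⟩
  refine 𝓖.compactOpenFun_induction (p := fun a => ∃ C : Set G, IsCompact C ∧
    ∀ b ∈ compactOpenFun G, 𝓖.IsRightInvariant b C →
      𝓖.conv b (𝓖.diagFun (𝓖.act n a)) = 𝓖.conv b (𝓖.conv (𝓖.diagFun n) a))
    (fun B hB => ?_) ?_ (fun a a' ha ha' ih ih' => ?_) (fun a ha ih => ?_) ha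
  · have hBm := 𝓖.indicator_mem hB
    induction hn using AddSubgroup.closure_induction with
    | mem n hn =>
      obtain ⟨K, hK, rfl⟩ := hn
      -- With `C = B ∩ r⁻¹(K)`, the two factors to be compared are `1_{s(C)}` and `1_C`, so
      -- `conv_indicator_eq_iff` applies.
      refine ⟨B ∩ 𝓖.rng ⁻¹' K, hB.isCompact.inter_right
        (hK.isCompact.isClosed.preimage 𝓖.continuous_rng), fun b hbm hb => ?_⟩
      have hBK : 𝓖.conv (𝓖.diagFun (K.indicator 1)) (B.indicator 1) =
          (B ∩ 𝓖.rng ⁻¹' K).indicator 1 := by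
        classical
        funext g
        rw [conv_diagFun]
        by_cases hgB : g ∈ B <;> by_cases hgK : 𝓖.rng g ∈ K <;> simp [hgB, hgK]
      rw [𝓖.act_indicator K hB.src_inj, diagFun_indicator, hBK]
      exact ((𝓖.conv_indicator_eq_iff (hB.src_inj.mono Set.inter_subset_left) b).2 hb).symm
    | zero =>
      refine ⟨∅, isCompact_empty, fun b _ _ => ?_⟩
      rw [act_zero_left, diagFun_zero, conv_zero_left]
    | add n n' hn hn' ih ih' =>
      obtain ⟨C, hC, h⟩ := ih
      obtain ⟨C', hC', h'⟩ := ih'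
      refine ⟨C ∪ C', hC.union hC', fun b hbm hb => ?_⟩
      rw [𝓖.act_add_left _ _ hBm, diagFun_add, diagFun_add, 𝓖.conv_add_right hbm,
        𝓖.conv_add_left (𝓖.diagFun_mem hn) (𝓖.diagFun_mem hn'), 𝓖.conv_add_right hbm,
        h b hbm (mono Set.subset_union_left hb), h' b hbm (mono Set.subset_union_right hb)]
    | neg n hn ih =>
      obtain ⟨C, hC, h⟩ := ih
      refine ⟨C, hC, fun b hbm hb => ?_⟩
      rw [act_neg_left, diagFun_neg, diagFun_neg, conv_neg_right, conv_neg_left, conv_neg_right,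
        h b hbm hb]
  · refine ⟨∅, isCompact_empty, fun b _ _ => ?_⟩
    rw [act_zero_right, diagFun_zero, conv_zero_right, conv_zero_right, conv_zero_right]
  · obtain ⟨C, hC, h⟩ := ih
    obtain ⟨C', hC', h'⟩ := ih'
    refine ⟨C ∪ C', hC.union hC', fun b hbm hb => ?_⟩
    rw [𝓖.act_add_right _ ha ha', diagFun_add, 𝓖.conv_add_right hbm,
      𝓖.conv_add_right (𝓖.diagFun_mem hn), 𝓖.conv_add_right hbm,
      h b hbm (mono Set.subset_union_left hb), h' b hbm (mono Set.subset_union_right hb)]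
  · obtain ⟨C, hC, h⟩ := ih
    refine ⟨C, hC, fun b hbm hb => ?_⟩
    rw [act_neg_right, diagFun_neg, conv_neg_right, conv_neg_right, conv_neg_right, h b hbm hb]

/-- The map `N ⊗_ℤ M → M`, `n ⊗ m ↦ n m`. -/
noncomputable def diagEval (M : Type u) [AddCommGroup M] [Module (AdjoinUnit 𝓖.Alg) M] :
    𝓖.Triv ⊗[ℤ] M →+ M :=
  TensorProduct.liftAddHom
    (AddMonoidHom.mk' (fun n => AddMonoidHom.mk' (fun m => incl (𝓖.diag n) • m) (smul_add _))
      fun n n' => AddMonoidHom.ext fun m => by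
        change incl (𝓖.diag (n + n')) • m = incl (𝓖.diag n) • m + incl (𝓖.diag n') • m
        rw [map_add, map_add, add_smul])
    fun k n m => by
      change incl (𝓖.diag (k • n)) • m = incl (𝓖.diag n) • (k • m)
      rw [map_zsmul, map_zsmul, smul_assoc, smul_comm]

/-- `diagEval` does not respect balancing: its defect on a relation is the difference between `n a`
taken in ℤ𝓖⁰ and in ℤ𝓖, acting on `m`. An invariant `b` removes this defect, and for finitely many
relations a union of compact sets suffices. -/
theorem exists_compact_smul_diagEval_eq_zero {M : Type u} [AddCommGroup M]
    [Module (AdjoinUnit 𝓖.Alg) M] {t : 𝓖.Triv ⊗[ℤ] M}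
    (ht : t ∈ balancedRel (AdjoinUnit 𝓖.Alg) 𝓖.Triv M) :
    ∃ C : Set G, IsCompact C ∧ ∀ b : 𝓖.Alg, 𝓖.IsRightInvariant b.1 C →
      incl b • 𝓖.diagEval M t = 0 := by
  induction ht using AddSubgroup.closure_induction with
  | mem t ht =>
    obtain ⟨n, s, m, rfl⟩ := ht
    obtain ⟨k, a, rfl⟩ := exists_eq_zsmul_add_incl s
    obtain ⟨C, hC, h⟩ := 𝓖.exists_compact_mul_diag_eq n a
    refine ⟨C, hC, fun b hb => ?_⟩
    rw [map_sub]
    change incl b • (incl (𝓖.diag (MulOpposite.op (k • 1 + incl a) • n)) • m -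
      incl (𝓖.diag n) • (k • 1 + incl a) • m) = 0
    have h1 : MulOpposite.op (k • 1 + incl a) • n = k • n + 𝓖.trivAct n a := by
      rw [MulOpposite.op_add, add_smul, 𝓖.op_incl_smul, MulOpposite.op_smul, smul_assoc,
        MulOpposite.op_one, one_smul]
    rw [h1, map_add, map_add, map_zsmul, map_zsmul, add_smul, add_smul, smul_add, smul_assoc k,
      smul_assoc k, one_smul, smul_comm k, add_sub_add_left_eq_sub, smul_sub, smul_smul, smul_smul,
      smul_smul, ← map_mul, ← map_mul, ← map_mul, _root_.mul_assoc, h b hb, sub_self]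
  | zero => exact ⟨∅, isCompact_empty, fun b _ => by rw [map_zero, smul_zero]⟩
  | add t t' _ _ ih ih' =>
    obtain ⟨C, hC, h⟩ := ih
    obtain ⟨C', hC', h'⟩ := ih'
    refine ⟨C ∪ C', hC.union hC', fun b hb => ?_⟩
    rw [map_add, smul_add, h b fun u hu => hb u (Or.inl hu), h' b fun u hu => hb u (Or.inr hu),
      add_zero]
  | neg t _ ih =>
    obtain ⟨C, hC, h⟩ := ih
    exact ⟨C, hC, fun b hb => by rw [map_neg, smul_neg, h b hb, neg_zero]⟩

variable {𝓖} in
-- By compactness, one member of the directed union contains both `C` and the units over `K`; its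
-- fundamental domain supplies `b`.
theorem IsAF.exists_invariant (h : 𝓖.IsAF) {C : Set G} (hC : IsCompact C) {K : Set X}
    (hK : IsCompact K) : ∃ b : 𝓖.Alg, 𝓖.IsRightInvariant b.1 C ∧ ∀ x ∈ K, 𝓖.act 1 b.1 x = 1 := by
  obtain ⟨S, hne, hdir, hS, hSH⟩ := h
  have : Nonempty S := hne.to_subtype
  obtain ⟨⟨H, hHS⟩, hH⟩ := (hC.union (hK.image 𝓖.continuous_one)).elim_directed_cover
    (fun H : S => H.1) (fun H => (hSH H H.2).2.1.isOpen)
    (by rw [← Set.sUnion_eq_iUnion, hS]; exact Set.subset_univ _) hdir.directed_val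
  obtain ⟨b, hbm, hb, hbs⟩ := exists_invariant_of_isPrincipalOn (hSH H hHS).1 (hSH H hHS).2.1
    (hSH H hHS).2.2
  exact ⟨⟨b, hbm⟩, fun u hu => hb u (hH (Or.inl hu)),
    fun x hx => hbs x (hH (Or.inr (Set.mem_image_of_mem _ hx)))⟩

variable {𝓖} in
theorem IsAF.isZero_homology_succ (h : 𝓖.IsAF) (n : ℕ) (M : UnitaryMod 𝓖.Alg) :
    Limits.IsZero (𝓖.homology (n + 1) M) := by
  refine isZero_Tor_succ_of_exists_tmul 𝓖.Triv (fun M M' g t ht => ?_) n M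
  obtain ⟨K, hK, m, rfl⟩ := 𝓖.exists_eq_tmul_unitInd t
  rw [BalancedTensor.map_tmul] at ht
  obtain ⟨C, hC, hC0⟩ := 𝓖.exists_compact_smul_diagEval_eq_zero
    ((QuotientAddGroup.eq_zero_iff _).1 ht)
  obtain ⟨b, hb, hbK⟩ := h.exists_invariant hC hK.isCompact
  -- The characteristic function of `L` replaces the constant function 1, with the same effect on
  -- `b`.
  obtain ⟨L, hL, hLo, hbL⟩ := 𝓖.exists_unit_support b.2
  have hL' := 𝓖.isCompactOpen_unit hL hLo
  refine ⟨𝓖.unitInd hL', incl (b * 𝓖.diag (𝓖.unitInd hK)) • m, ?_, ?_⟩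
  · rw [map_smul, map_mul, mul_smul]
    exact hC0 b hb
  -- Moved to the left, `b 1_K` takes `1_L` to the fibre sums of `b` cut down to `K`, which is
  -- `1_K`.
  · rw [← BalancedTensor.smul_tmul, 𝓖.op_incl_smul, 𝓖.trivAct_mul]
    congr 1
    refine Subtype.ext (funext fun x => ?_)
    refine Eq.trans ?_ (𝓖.act_diagFun (𝓖.act (L.indicator 1) b.1) (K.indicator 1) x).symm
    have h1 : 𝓖.act (L.indicator 1) b.1 x = 𝓖.act 1 b.1 x := finsum_congr fun g => by
      by_cases hg : b.1 g.1 = 0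
      · rw [hg, mul_zero, mul_zero]
      · rw [Set.indicator_of_mem (hbL _ hg)]
    change K.indicator 1 x = _
    by_cases hx : x ∈ K
    · rw [h1, hbK x hx, _root_.one_mul]
    · rw [Set.indicator_of_notMem hx, mul_zero]

end Flatness

/-! ### Vanishing of the first homology implies AF. -/

section Converse

variable [𝓖.IsAmple]

/-- If `Tor_1` vanishes, then there are functions in `ℤ𝓖` with sum `1` over the arrows starting at
a unit of `W` which are invariant under right multiplication by `W`. -/
theorem exists_invariant_of_isZero_homology_one
    (h : ∀ M : UnitaryMod 𝓖.Alg, Limits.IsZero (𝓖.homology 1 M)) {W : Set G} (hWc : IsCompact W)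
    (hWo : IsOpen W) (hr : ∀ w ∈ W, 𝓖.rng w ∈ 𝓖.src '' W) :
    ∃ b ∈ compactOpenFun G, 𝓖.IsRightInvariant b W ∧ ∀ x ∈ 𝓖.src '' W, 𝓖.act 1 b x = 1 := by
  have hK : IsCompactOpen (𝓖.src '' W) := 𝓖.isCompactOpen_unit (hWc.image 𝓖.continuous_src)
    (isOpenMap_src _ hWo)
  set K := 𝓖.src '' W with hKdef
  choose! B hB hgB hBW using fun g (hg : g ∈ W) => 𝓖.exists_bisection hWo hg
  obtain ⟨t, htW, hcov⟩ := hWc.elim_nhds_subcover B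
    fun g hg => (hB g hg).isOpen.mem_nhds (hgB g hg)
  have hBt : ∀ i : t, 𝓖.IsCompactBisection (B i) := fun i => hB i (htW i i.2)
  have hBK : ∀ i : t, IsCompactOpen (𝓖.src '' B i) := fun i =>
    𝓖.isCompactOpen_unit ((hBt i).isCompact.image 𝓖.continuous_src)
      (isOpenMap_src _ (hBt i).isOpen)
  have hsub : ∀ i : t, B i ⊆ W := fun i => hBW i (htW i i.2)
  let e : 𝓖.Alg := 𝓖.diag (𝓖.unitInd hK)
  -- Being annihilated by right multiplication by `a i` means being invariant under `B i`.
  let a : t → 𝓖.Alg := fun i => 𝓖.bisInd (hBt i) - 𝓖.diag (𝓖.unitInd (hBK i))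
  have hBsub : ∀ i : t, 𝓖.src '' B i ⊆ K := fun i => Set.image_mono (hsub i)
  have hsupp : ∀ i g, (a i).1 g ≠ 0 → g ∈ B i ∨ ∃ x ∈ K, 𝓖.one x = g := by
    intro i g hg
    by_contra! hn
    refine hg (sub_eq_zero.2 ((Set.indicator_of_notMem hn.1 _).trans ?_))
    by_contra hne
    obtain ⟨x, hx, hxg⟩ := 𝓖.mem_of_diag_unitInd_ne_zero (hBK i) (Ne.symm hne)
    exact hn.2 x (hBsub i hx) hxg
  have he : e * e = e := 𝓖.diag_unitInd_mul hK e fun g hg => by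
    obtain ⟨x, hx, rfl⟩ := 𝓖.mem_of_diag_unitInd_ne_zero hK hg
    rwa [𝓖.rng_one]
  have hea : ∀ i, e * a i = a i := fun i => 𝓖.diag_unitInd_mul hK _ fun g hg => by
    obtain hg | ⟨x, hx, rfl⟩ := hsupp i g hg
    · exact hr g (hsub i hg)
    · rwa [𝓖.rng_one]
  have hae : ∀ i, a i * e = a i := fun i => 𝓖.mul_diag_unitInd hK _ fun g hg => by
    obtain hg | ⟨x, hx, rfl⟩ := hsupp i g hg
    · exact hBsub i ⟨g, hg, rfl⟩
    · rwa [𝓖.src_one]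
  -- Both terms of `a i` take `1_K` to the characteristic function of `s(B i)`, since the ranges and
  -- sources of `B i` lie in `K`.
  have hmem := mem_closure_of_isZero_Tor_one 𝓖.Triv h he a hae (𝓖.unitInd hK) fun i => by
    rw [hea, 𝓖.op_incl_smul, map_sub, 𝓖.trivAct_bisInd hK (hBt i) (hBK i)
      fun g hg => hr g (hsub i hg), 𝓖.trivAct_diag_unitInd hK (hBK i) (hBsub i), sub_self]
  -- The solutions of `b * a i = 0` form a left ideal, so the sum given by the criterion collapses
  -- to one `b`.
  have key : ∀ y ∈ AddSubgroup.closure {x : 𝓖.Triv | ∃ (n' : 𝓖.Triv) (b : 𝓖.Alg),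
      (∀ i, b * a i = 0) ∧ x = MulOpposite.op (incl b) • n'},
      ∃ b : 𝓖.Alg, (∀ i, b * a i = 0) ∧ 𝓖.act 1 b.1 = y.1 := by
    intro y hy
    induction hy using AddSubgroup.closure_induction with
    | mem y hy =>
      obtain ⟨n, b, hb, rfl⟩ := hy
      refine ⟨𝓖.diag n * b, fun i => by rw [_root_.mul_assoc, hb, mul_zero], ?_⟩
      rw [𝓖.op_incl_smul]
      exact 𝓖.act_one_conv_diagFun n.1 b.1
    | zero => exact ⟨0, fun i => zero_mul _, 𝓖.act_zero_right _⟩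
    | add y y' _ _ ih ih' =>
      obtain ⟨b, hb, hby⟩ := ih
      obtain ⟨b', hb', hby'⟩ := ih'
      refine ⟨b + b', fun i => by rw [add_mul, hb, hb', add_zero], ?_⟩
      exact (𝓖.act_add_right 1 b.2 b'.2).trans (congrArg₂ _ hby hby')
    | neg y _ ih =>
      obtain ⟨b, hb, hby⟩ := ih
      refine ⟨-b, fun i => by rw [neg_mul, hb, neg_zero], ?_⟩
      exact (𝓖.act_neg_right 1 b.1).trans (congrArg _ hby)
  obtain ⟨b, hb, hbe⟩ := key _ hmem
  refine ⟨b.1, b.2, fun u hu => ?_, fun x hx => ?_⟩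
  · obtain ⟨i, hi, hui⟩ := Set.mem_iUnion₂.1 (hcov hu)
    have h1 : b * 𝓖.bisInd (hBt ⟨i, hi⟩) = b * 𝓖.diag (𝓖.unitInd (hBK ⟨i, hi⟩)) :=
      sub_eq_zero.1 ((mul_sub _ _ _).symm.trans (hb ⟨i, hi⟩))
    refine (𝓖.conv_indicator_eq_iff (hBt ⟨i, hi⟩).src_inj b.1).1 ?_ u hui
    exact (congrArg Subtype.val h1).trans (congrArg (𝓖.conv b.1) (𝓖.diagFun_indicator _))
  · rw [hbe, 𝓖.op_incl_smul, 𝓖.trivAct_diag_unitInd hK hK subset_rfl]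
    exact Set.indicator_of_mem hx _

/-- It suffices to enclose every compact open set of arrows in a compact open principal subgroupoid;
this yields both directedness and covering. -/
theorem isAF_of_isZero_homology_one
    (h : ∀ M : UnitaryMod 𝓖.Alg, Limits.IsZero (𝓖.homology 1 M)) : 𝓖.IsAF := by
  have key : ∀ C : Set G, IsCompact C → IsOpen C →
      ∃ H, C ⊆ H ∧ 𝓖.IsSubgroupoid H ∧ IsCompactOpen H ∧ 𝓖.IsPrincipalOn H := by
    intro C hC hCo
    -- `C` is made symmetric and the units at its sources and ranges are added.
    let W := (C ∪ 𝓖.inv ⁻¹' C) ∪ 𝓖.one '' (𝓖.src '' C ∪ 𝓖.rng '' C)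
    have himg : 𝓖.inv ⁻¹' C = 𝓖.inv '' C :=
      (congrFun (Set.image_eq_preimage_of_inverse 𝓖.inv_inv 𝓖.inv_inv) C).symm
    have hWc : IsCompact W := by
      refine (hC.union ?_).union (((hC.image 𝓖.continuous_src).union
        (hC.image 𝓖.continuous_rng)).image 𝓖.continuous_one)
      rw [himg]
      exact hC.image 𝓖.continuous_inv
    have hWo : IsOpen W := (hCo.union (hCo.preimage 𝓖.continuous_inv)).union
      (𝓖.one_localHomeo.isOpenMap _ ((isOpenMap_src _ hCo).union
        (𝓖.rng_localHomeo.isOpenMap _ hCo)))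
    have hsrc : ∀ w ∈ W, 𝓖.one (𝓖.src w) ∈ W := by
      rintro w ((hw | hw) | ⟨x, hx, rfl⟩)
      · exact Or.inr ⟨_, Or.inl ⟨w, hw, rfl⟩, rfl⟩
      · exact Or.inr ⟨_, Or.inr ⟨_, hw, 𝓖.rng_inv w⟩, rfl⟩
      · rw [𝓖.src_one]
        exact Or.inr ⟨x, hx, rfl⟩
    have hinv : ∀ w ∈ W, 𝓖.inv w ∈ W := by
      rintro w ((hw | hw) | ⟨x, hx, rfl⟩)
      · refine Or.inl (Or.inr ?_)
        rwa [Set.mem_preimage, 𝓖.inv_inv]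
      · exact Or.inl (Or.inl hw)
      · rw [𝓖.inv_one]
        exact Or.inr ⟨x, hx, rfl⟩
    obtain ⟨b, hbm, hb, hb1⟩ := 𝓖.exists_invariant_of_isZero_homology_one h hWc hWo
      fun w hw => ⟨_, hinv w hw, 𝓖.src_inv w⟩
    obtain ⟨H, hWH, hH⟩ := exists_subgroupoid_of_isRightInvariant hWc hWo hinv hsrc hb hbm
      fun x hx => hb1 x ⟨_, hx, 𝓖.src_one x⟩
    exact ⟨H, (Set.subset_union_left.trans Set.subset_union_left).trans hWH, hH⟩
  refine ⟨{H | 𝓖.IsSubgroupoid H ∧ IsCompactOpen H ∧ 𝓖.IsPrincipalOn H}, ?_, ?_, ?_,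
    fun H hH => hH⟩
  · obtain ⟨H, -, hH⟩ := key ∅ isCompact_empty isOpen_empty
    exact ⟨H, hH⟩
  · intro H hH H' hH'
    -- `H ∪ H'` need not be Hausdorff, but `key` asks only for a quasi-compact open set.
    obtain ⟨L, hL, hL'⟩ := key (H ∪ H') (hH.2.1.isCompact.union hH'.2.1.isCompact)
      (hH.2.1.isOpen.union hH'.2.1.isOpen)
    exact ⟨L, hL', Set.subset_union_left.trans hL, Set.subset_union_right.trans hL⟩
  · refine Set.eq_univ_of_forall fun g => ?_
    obtain ⟨B, hB, hg, -⟩ := 𝓖.exists_bisection isOpen_univ (Set.mem_univ g)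
    obtain ⟨H, hBH, hH⟩ := key B hB.isCompact hB.isOpen
    exact ⟨H, hH, hBH hg⟩

/-- In `ℕ∞` the supremum of the empty set is `⊥ = 0`, so the supremum is 0 exactly when no positive
degree occurs; degree 0 has no influence. -/
theorem homologicalDimension_eq_zero_iff :
    𝓖.homologicalDimension = 0 ↔
      ∀ n : ℕ, 0 < n → ∀ M : UnitaryMod 𝓖.Alg, Limits.IsZero (𝓖.homology n M) := by
  rw [homologicalDimension, ← bot_eq_zero, sSup_eq_bot]
  constructor
  · intro h n hn M
    by_contra hM
    exact hn.ne' (Nat.cast_eq_zero.1 (h n ⟨n, rfl, M, hM⟩))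
  · rintro h _ ⟨n, rfl, M, hM⟩
    obtain rfl | hn := n.eq_zero_or_pos
    · rfl
    · exact (hM (h n hn M)).elim

end Converse

end TopGroupoid

end AmpleHomology

theorem theoremA {X G : Type u} [TopologicalSpace X] [TopologicalSpace G]
    (𝓖 : AmpleHomology.TopGroupoid X G) [𝓖.IsAmple] :
    (𝓖.IsAF ↔ 𝓖.homologicalDimension = 0) ∧
      (𝓖.homologicalDimension = 0 ↔
        ∀ n : ℕ, 0 < n → ∀ M : AmpleHomology.UnitaryMod 𝓖.Alg,
          CategoryTheory.Limits.IsZero (𝓖.homology n M)) := by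
  refine ⟨?_, 𝓖.homologicalDimension_eq_zero_iff⟩
  rw [𝓖.homologicalDimension_eq_zero_iff]
  refine ⟨fun h n hn M => ?_, fun h => 𝓖.isAF_of_isZero_homology_one (h 1 one_pos)⟩
  obtain ⟨n, rfl⟩ := Nat.exists_eq_add_one.2 hn
  exact h.isZero_homology_succ n M
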